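/- Let $n\ge 1$ and $0<\delta<1$. Write $\|\cdot\|_2$ for the norm of $L^2(\mathbb{R}^n)$ (complex-valued functions), $\hat f(\xi)=\int_{\mathbb{R}^n} e^{-2\pi i x\cdot\xi}f(x)\,dx$ for the Fourier transform, extended to $L^2$, and let $D^\delta$ be given by $(D^\delta f)^\wedge(\xi)=|\xi|^\delta\hat f(\xi)$, so that $\|D^\delta f\|_2=\||\xi|^\delta\hat f\|_2$. Let $$\Sigma_\delta=\Sigma_\delta(\mathbb{R}^n)=\{f\in L^2(\mathbb{R}^n) : \||x|^\delta f\|_2<\infty \text{ and } \|D^\delta f\|_2<\infty\}.$$ For $f\in L^2(\mathbb{R}^n)$ let $u(x,t)$ be the solution of $\partial_t u=\frac{i}{4\pi}\Delta u$ with $u(x,0)=f(x)$, that is, $\hat u(\xi,t)=e^{-\pi i t|\xi|^2}\hat f(\xi)$, and let $$h_\delta[f](t)=\int_{\mathbb{R}^n}|x|^{2\delta}|u(x,t)|^2\,dx\in[0,\infty].$$ Let $a_\delta\ge 0$ be defined by $$a_\delta^2=\inf\{\||x|^\delta f\|_2\,\|D^\delta f\|_2 : f\in\Sigma_\delta,\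 \|f\|_2=1\}.$$ Then $a_\delta>0$, and there is a unique $Q_\delta\in\Sigma_\delta$ with $Q_\delta>0$ almost everywhere, $\|Q_\delta\|_2=1$, $\||x|^\delta Q_\delta\|_2=\|D^\delta Q_\delta\|_2$ and $\||x|^\delta Q_\delta\|_2\,\|D^\delta Q_\delta\|_2=a_\delta^2$. With this $a_\delta$ and $Q_\delta$, every $f\in\Sigma_\delta$ with $\|f\|_2=1$ satisfies, for all $t\in\mathbb{R}$, $$h_\delta[f](t)\ge\Big(\frac{a_\delta^2}{\||x|^\delta f\|_2\,\|D^\delta f\|_2}\Big)^2\max\big(\||x|^\delta f\|_2^2,\ \|D^\delta f\|_2^2\,|t|^{2\delta}\big).$$ Furthermore, for every real $T\ne 0$, $$h_\delta[f](0)\,h_\delta[f](T)\ge a_\delta^4|T|^{2\delta},$$ with equality if and only if $f(x)=c\,e^{-\pi i|x|^2/T}\lambda^{n/2}Q_\delta(\lambda x)$ for almost every $x$, for some $\lambda>0$ and some $c\in\mathbb{C}$ with $|c|=1$. -/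

import Mathlib

open MeasureTheory FourierTransform Laplacian
open scoped SchwartzMap ENNReal

noncomputable section

/-- The Hilbert space `L²(ℝⁿ)` of complex-valued functions, with Lebesgue measure. -/
abbrev L2 (n : ℕ) : Type :=
  Lp ℂ 2 (volume : Measure (EuclideanSpace ℝ (Fin n)))

/-- The function `|x|^δ f(x)`. -/
def weighted {n : ℕ} (δ : ℝ) (f : L2 n) (x : EuclideanSpace ℝ (Fin n)) : ℂ :=
  ((‖x‖ ^ δ : ℝ) : ℂ) * f x

/-- The function `|ξ|^δ f̂(ξ)` on the frequency side, where `𝓕` is the Fourier transform on `L²`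
with kernel `e^{-2πi x·ξ}`. Its `L²` norm is, by Plancherel, the `L²` norm of `D^δ f`. -/
def fracDeriv {n : ℕ} (δ : ℝ) (f : L2 n) (ξ : EuclideanSpace ℝ (Fin n)) : ℂ :=
  ((‖ξ‖ ^ δ : ℝ) : ℂ) * (𝓕 f : L2 n) ξ

/-- The space `Σ_δ(ℝⁿ)`: those `f ∈ L²` with `‖|x|^δ f‖₂ < ∞` and `‖D^δ f‖₂ < ∞`. -/
def MemSigma {n : ℕ} (δ : ℝ) (f : L2 n) : Prop :=
  MemLp (weighted δ f) 2 volume ∧ MemLp (fracDeriv δ f) 2 volume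

/-- `‖|x|^δ f‖₂`, to be used for `f ∈ Σ_δ`. -/
def weightNorm {n : ℕ} (δ : ℝ) (f : L2 n) : ℝ :=
  (eLpNorm (weighted δ f) 2 volume).toReal

/-- `‖D^δ f‖₂`, to be used for `f ∈ Σ_δ`. -/
def fracDerivNorm {n : ℕ} (δ : ℝ) (f : L2 n) : ℝ :=
  (eLpNorm (fracDeriv δ f) 2 volume).toReal

/-- The sharp constant `a_δ ≥ 0` of the static uncertainty principle:
`a_δ² = inf { ‖|x|^δ f‖₂ ‖D^δ f‖₂ : f ∈ Σ_δ, ‖f‖₂ = 1 }`. -/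
def sharpConst (n : ℕ) (δ : ℝ) : ℝ :=
  √(sInf {r : ℝ | ∃ f : L2 n, MemSigma δ f ∧ ‖f‖ = 1 ∧
    r = weightNorm δ f * fracDerivNorm δ f})

/-- `Q` is the (a.e.) positive, `L²`-normalized and balanced minimizer of the static uncertainty
principle. -/
structure IsPositiveMinimizer {n : ℕ} (δ : ℝ) (Q : L2 n) : Prop where
  memSigma : MemSigma δ Q
  norm_eq_one : ‖Q‖ = 1
  pos : ∀ᵐ x, 0 < (Q x).re ∧ (Q x).im = 0
  balanced : weightNorm δ Q = fracDerivNorm δ Q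
  minimizes : weightNorm δ Q * fracDerivNorm δ Q = sharpConst n δ ^ 2

/-- The function `e^{-πi t |ξ|²} f̂(ξ)`. -/
def evolvedFourier {n : ℕ} (f : L2 n) (t : ℝ) (ξ : EuclideanSpace ℝ (Fin n)) : ℂ :=
  Complex.exp (((-Real.pi * t * ‖ξ‖ ^ 2 : ℝ) : ℂ) * Complex.I) * (𝓕 f : L2 n) ξ

theorem memLp_evolvedFourier {n : ℕ} (f : L2 n) (t : ℝ) :
    MemLp (evolvedFourier f t) 2 volume := by
  refine (Lp.memLp (𝓕 f : L2 n)).of_le ?_ ?_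
  · refine AEStronglyMeasurable.mul (Continuous.aestronglyMeasurable (by fun_prop)) ?_
    exact (Lp.memLp (𝓕 f : L2 n)).1
  · refine Filter.Eventually.of_forall fun ξ => ?_
    simp only [evolvedFourier, norm_mul, Complex.norm_exp_ofReal_mul_I, one_mul, le_refl]

/-- The solution `u(·, t) ∈ L²(ℝⁿ)` of `∂ₜ u = (i/2) ħ Δ u`, `ħ = 1/(2π)`, with `u(·, 0) = f`:
`û(ξ, t) = e^{-πi t |ξ|²} f̂(ξ)`. -/
def schrodinger {n : ℕ} (f : L2 n) (t : ℝ) : L2 n :=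
  𝓕⁻ ((memLp_evolvedFourier f t).toLp (evolvedFourier f t))

/-- `h_δ[f](t) = ∫ |x|^{2δ} |u(x, t)|² dx ∈ [0, ∞]`. -/
def hDelta {n : ℕ} (δ : ℝ) (f : L2 n) (t : ℝ) : ℝ≥0∞ :=
  ∫⁻ x, ENNReal.ofReal (‖x‖ ^ (2 * δ) * ‖schrodinger f t x‖ ^ 2)

/-- `schrodinger f` takes the initial value `f`. -/
theorem schrodinger_zero {n : ℕ} (f : L2 n) : schrodinger f 0 = f := by
  have : (memLp_evolvedFourier f 0).toLp (evolvedFourier f 0) = 𝓕 f := by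
    apply Lp.ext
    filter_upwards [(memLp_evolvedFourier f 0).coeFn_toLp] with ξ hξ
    simp [hξ, evolvedFourier]
  rw [schrodinger, this, FourierTransform.fourierInv_fourier_eq]

/-- Pairing with a Schwartz function on the frequency side. -/
theorem integral_schrodinger_mul {n : ℕ} (f : L2 n) (t : ℝ)
    (φ : 𝓢(EuclideanSpace ℝ (Fin n), ℂ)) :
    ∫ x, φ x * schrodinger f t x = ∫ ξ, (𝓕⁻ φ) ξ * evolvedFourier f t ξ := by
  have h := congrArg (fun T : 𝓢'(EuclideanSpace ℝ (Fin n), ℂ) => T φ)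
    (Lp.fourierInv_toTemperedDistribution_eq
      ((memLp_evolvedFourier f t).toLp (evolvedFourier f t)))
  simp only [TemperedDistribution.fourierInv_apply, Lp.toTemperedDistribution_apply] at h
  rw [schrodinger]
  simp only [smul_eq_mul] at h
  rw [← h]
  refine integral_congr_ae ?_
  filter_upwards [(memLp_evolvedFourier f t).coeFn_toLp] with ξ hξ
  rw [hξ]

/-- The Laplacian becomes multiplication by `-4π²|ξ|²` on the frequency side. -/
theorem fourierInv_laplacian_apply {n : ℕ} (φ : 𝓢(EuclideanSpace ℝ (Fin n), ℂ))
    (ξ : EuclideanSpace ℝ (Fin n)) :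
    (𝓕⁻ (Δ φ)) ξ = ((-(2 * Real.pi) ^ 2 * ‖ξ‖ ^ 2 : ℝ) : ℂ) * (𝓕⁻ φ) ξ := by
  have key : 𝓕 (Δ φ) = (-(2 * Real.pi) ^ 2 : ℝ) •
      SchwartzMap.smulLeftCLM ℂ (fun x : EuclideanSpace ℝ (Fin n) => ‖x‖ ^ 2) (𝓕 φ) := by
    rw [SchwartzMap.laplacian_eq_fourierMultiplierCLM, SchwartzMap.fourierMultiplierCLM_apply,
      FourierTransform.fourier_smul, FourierTransform.fourier_fourierInv_eq]
  have hneg : ∀ g : 𝓢(EuclideanSpace ℝ (Fin n), ℂ), (𝓕⁻ g) ξ = (𝓕 g) (-ξ) := by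
    intro g
    rw [SchwartzMap.fourierInv_coe, SchwartzMap.fourier_coe,
      Real.fourierInv_eq_fourier_neg]
  rw [hneg, hneg, key, _root_.smul_apply,
    SchwartzMap.smulLeftCLM_apply_apply (by fun_prop)]
  simp only [norm_neg, Complex.real_smul]
  push_cast
  ring

/-- `schrodinger f` solves `∂ₜ u = (i/2) ħ Δ u`, `ħ = 1/(2π)`, in the sense of distributions. -/
theorem hasDerivAt_schrodinger {n : ℕ} (f : L2 n) (t : ℝ)
    (φ : 𝓢(EuclideanSpace ℝ (Fin n), ℂ)) :
    HasDerivAt (fun s : ℝ => ∫ x, φ x * schrodinger f s x)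
      (Complex.I / 2 * (1 / (2 * Real.pi)) * ∫ x, (Δ φ) x * schrodinger f t x) t := by
  have hint : ∀ (s : ℝ) (g : 𝓢(EuclideanSpace ℝ (Fin n), ℂ)),
      Integrable (fun ξ => g ξ * evolvedFourier f s ξ) := fun s g =>
    (g.memLp 2 volume).integrable_mul (memLp_evolvedFourier f s)
  have hbound : Integrable (fun ξ : EuclideanSpace ℝ (Fin n) =>
      ‖(𝓕⁻ (Δ φ)) ξ * (𝓕 f : L2 n) ξ‖ / (4 * Real.pi)) :=
    (((𝓕⁻ (Δ φ)).memLp 2 volume).integrable_mul (Lp.memLp (𝓕 f : L2 n))).norm.div_const _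
  simp only [integral_schrodinger_mul]
  rw [← integral_const_mul]
  refine (hasDerivAt_integral_of_dominated_loc_of_deriv_le
    (F := fun s ξ => (𝓕⁻ φ) ξ * evolvedFourier f s ξ)
    (F' := fun s ξ => Complex.I / 2 * (1 / (2 * Real.pi)) *
      ((𝓕⁻ (Δ φ)) ξ * evolvedFourier f s ξ))
    (s := Set.univ) Filter.univ_mem ?_ (hint t _) ?_ ?_ hbound ?_).2
  · exact Filter.Eventually.of_forall fun s => (hint s _).1
  · exact ((hint t _).const_mul _).1
  · refine Filter.Eventually.of_forall fun ξ s _ => le_of_eq ?_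
    have hpi : |Real.pi| = Real.pi := abs_of_pos Real.pi_pos
    simp only [evolvedFourier, norm_mul, Complex.norm_exp_ofReal_mul_I, one_mul, norm_div,
      Complex.norm_I, norm_one, Complex.norm_real, Real.norm_eq_abs, hpi, Complex.norm_ofNat]
    field_simp
    ring
  · refine Filter.Eventually.of_forall fun ξ s _ => ?_
    have h1 : HasDerivAt (fun r : ℝ => (((-Real.pi * r * ‖ξ‖ ^ 2 : ℝ) : ℂ) * Complex.I))
        (((-Real.pi * ‖ξ‖ ^ 2 : ℝ) : ℂ) * Complex.I) s := by
      refine HasDerivAt.mul_const (HasDerivAt.ofReal_comp ?_) _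
      simpa using ((hasDerivAt_id s).const_mul (-Real.pi)).mul_const (‖ξ‖ ^ 2)
    have h2 := ((h1.cexp).mul_const ((𝓕 f : L2 n) ξ)).const_mul ((𝓕⁻ φ) ξ)
    simp only [evolvedFourier]
    convert! h2 using 1
    rw [fourierInv_laplacian_apply]
    have : (Real.pi : ℂ) ≠ 0 := by exact_mod_cast Real.pi_ne_zero
    push_cast
    field_simp

end

noncomputable section
open Filter Topology

/-! The evolution reduces to a static problem. Expanding the square in the Fresnel kernel gives
`schrodinger_eq_fresnel`: up to a unimodular constant, u(·,T) is a chirp times the dilate by 1/T of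
the Fourier transform of g = e^{πi|x|²/T} f. Hence h(T) = |T|^{2δ} ∫|ξ|^{2δ}|ĝ|², while h(0) =
∫|x|^{2δ}|g|² because |g| = |f|. The product bound and its equality cases are therefore those of the
static uncertainty principle for g. In the pointwise bound, the |t|^{2δ} term is this product bound
divided by h(0), and the other term is the static principle for u(·,t), whose Fourier transform has
the same modulus as that of f.

For the static principle, put E(f) = ∫|x|^{2δ}|f|² + ∫|ξ|^{2δ}|f̂|² and let E₀ be its minimum on the
unit sphere. Dilation preserves the product of the two moments and can make them equal, so a_δ² =
E₀/2, and minimizers of the product are dilates of minimizers of E. A minimizer of E exists by the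
direct method: bounded energy controls the tails in space and in frequency, localization to balls in
both is compact, and E is lower semicontinuous by Fatou.

Uniqueness uses two structures. E is a quadratic form, so by the parallelogram law differences of
ground states are ground states. For 0 < δ < 1 the frequency part is a multiple of the Gagliardo
form ∬|f(y)-f(x)|²|y-x|^{-(n+2δ)}, which does not increase under f ↦ |f|; equality forces a constant
phase. Thus the difference of two nonnegative ground states of equal norm has one sign, and is zero.

Positivity comes from comparing a nonnegative ground state Q with a small bump g = εη. Replacing (Q,
g) by their maximum and minimum lowers the Gagliardo energy by at least a fixed multiple of N =
‖(g-Q)₊‖₁, while replacing g by min(Q, g) can save at most O(ε)N. Since the maximum cannot have less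
energy than Q, small ε forces N = 0, that is Q ≥ εη. -/

/-- The space `ℝⁿ` with its Euclidean norm. -/
abbrev Rn (n : ℕ) : Type := EuclideanSpace ℝ (Fin n)

variable {n : ℕ}

/-! ### The Fourier transform on `L¹ ∩ L²` -/

/-- Real smooth compactly supported functions, viewed as complex Schwartz functions, already
separate locally integrable functions. -/
theorem L2.ae_eq_of_forall_schwartz (f : L2 n) {g : Rn n → ℂ} (hg : Continuous g)
    (h : ∀ φ : 𝓢(Rn n, ℂ), ∫ x, φ x * f x = ∫ x, φ x * g x) : f =ᵐ[volume] g := by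
  refine ae_eq_of_integral_contDiff_smul_eq ((Lp.memLp f).locallyIntegrable (by norm_num))
    hg.locallyIntegrable fun η η_smooth η_cpt => ?_
  have h₁ : HasCompactSupport (Complex.ofRealCLM ∘ η) := η_cpt.comp_left rfl
  have h₂ : ContDiff ℝ (⊤ : ℕ∞) (Complex.ofRealCLM ∘ η) := by fun_prop
  simpa using h (h₁.toSchwartzMap h₂)

/-- Both transforms are adjoint to the Schwartz transform: the `L²` one through tempered
distributions, the integral one by Fubini. -/
theorem fourier_ae_eq_of_integrable (f : L2 n) (hf : Integrable f volume) :
    (𝓕 f : L2 n) =ᵐ[volume] 𝓕 (f : Rn n → ℂ) := by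
  refine L2.ae_eq_of_forall_schwartz _ (VectorFourier.fourierIntegral_continuous
    Real.continuous_fourierChar (by exact continuous_inner) hf) fun φ => ?_
  have h := congrArg (fun S : 𝓢'(Rn n, ℂ) => S φ) (Lp.fourier_toTemperedDistribution_eq f)
  simp only [TemperedDistribution.fourier_apply, Lp.toTemperedDistribution_apply,
    smul_eq_mul] at h
  rw [← h]
  exact VectorFourier.integral_fourierIntegral_smul_eq_flip (L := innerₗ (Rn n))
    Real.continuous_fourierChar continuous_inner φ.integrable hf |>.trans (by
      rw [flip_innerₗ]; rfl)

theorem fourierInv_ae_eq_of_integrable (f : L2 n) (hf : Integrable f volume) :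
    (𝓕⁻ f : L2 n) =ᵐ[volume] 𝓕⁻ (f : Rn n → ℂ) := by
  have hc : Continuous fun p : Rn n × Rn n => (-innerₗ (Rn n)) p.1 p.2 := by
    exact (continuous_inner (𝕜 := ℝ) (E := Rn n)).neg
  refine L2.ae_eq_of_forall_schwartz _ (VectorFourier.fourierIntegral_continuous
    Real.continuous_fourierChar hc hf) fun φ => ?_
  have h := congrArg (fun S : 𝓢'(Rn n, ℂ) => S φ) (Lp.fourierInv_toTemperedDistribution_eq f)
  simp only [TemperedDistribution.fourierInv_apply, Lp.toTemperedDistribution_apply,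
    smul_eq_mul] at h
  rw [← h]
  have := VectorFourier.integral_fourierIntegral_smul_eq_flip (L := -innerₗ (Rn n))
    Real.continuous_fourierChar hc (φ.integrable (μ := volume)) hf
  have e : (-innerₗ (Rn n)).flip = -innerₗ (Rn n) := by
    ext x y; simp [real_inner_comm]
  rw [e] at this
  rw [SchwartzMap.fourierInv_coe]
  exact this

/-! ### Weighted composition operators -/

/-- The isometry `f ↦ m · (f ∘ h)` of `L²(ℝⁿ)`. -/
def weightedComp (m : Rn n → ℂ) (h : Rn n → Rn n) (hm : AEStronglyMeasurable m volume)
    (hh : Measure.QuasiMeasurePreserving h volume volume)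
    (hiso : ∀ f : L2 n, eLpNorm (fun x => m x * f (h x)) 2 volume = eLpNorm f 2 volume) :
    L2 n →ₗᵢ[ℂ] L2 n :=
  have hmem : ∀ f : L2 n, MemLp (fun x => m x * f (h x)) 2 volume := fun f =>
    ⟨hm.mul ((Lp.aestronglyMeasurable f).comp_quasiMeasurePreserving hh),
      (hiso f).trans_lt (Lp.memLp f).2⟩
  { toFun := fun f => (hmem f).toLp _
    map_add' := fun f g => by
      apply Lp.ext
      filter_upwards [(hmem (f + g)).coeFn_toLp, (hmem f).coeFn_toLp, (hmem g).coeFn_toLp,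
        Lp.coeFn_add ((hmem f).toLp _) ((hmem g).toLp _),
        hh.ae (Lp.coeFn_add f g)] with x h1 h2 h3 h4 h5
      rw [h1, h4, Pi.add_apply, h2, h3, h5, Pi.add_apply, mul_add]
    map_smul' := fun c f => by
      apply Lp.ext
      filter_upwards [(hmem (c • f)).coeFn_toLp, (hmem f).coeFn_toLp,
        Lp.coeFn_smul c ((hmem f).toLp _), hh.ae (Lp.coeFn_smul c f)] with x h1 h2 h4 h5
      simp only [RingHom.id_apply]
      rw [h1, h4, Pi.smul_apply, h2, h5, Pi.smul_apply, smul_eq_mul, smul_eq_mul]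
      ring
    norm_map' := fun f => by
      simp only [LinearMap.coe_mk, AddHom.coe_mk]
      rw [Lp.norm_toLp, hiso, Lp.norm_def] }

theorem weightedComp_ae (m : Rn n → ℂ) (h : Rn n → Rn n) (hm : AEStronglyMeasurable m volume)
    (hh : Measure.QuasiMeasurePreserving h volume volume)
    (hiso : ∀ f : L2 n, eLpNorm (fun x => m x * f (h x)) 2 volume = eLpNorm f 2 volume)
    (f : L2 n) : weightedComp m h hm hh hiso f =ᵐ[volume] fun x => m x * f (h x) :=
  MemLp.coeFn_toLp (p := 2) ⟨hm.mul ((Lp.aestronglyMeasurable f).comp_quasiMeasurePreserving hh),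
    (hiso f).trans_lt (Lp.memLp f).2⟩

theorem quasiMeasurePreserving_smul_volume {s : ℝ} (hs : s ≠ 0) :
    Measure.QuasiMeasurePreserving (fun x : Rn n => s • x) volume volume :=
  Measure.quasiMeasurePreserving_smul volume hs

theorem lintegral_comp_smul' (f : Rn n → ℝ≥0∞) {s : ℝ} (hs : s ≠ 0) :
    ∫⁻ x, f (s • x) = ENNReal.ofReal (|s| ^ (-(n : ℝ))) * ∫⁻ x, f x := by
  have h1 := Measure.map_addHaar_smul (volume : Measure (Rn n)) hs
  have h2 : ∫⁻ x, f (s • x) = ∫⁻ x, f x ∂(Measure.map (s • ·) volume) :=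
    ((Homeomorph.smulOfNeZero s hs).toMeasurableEquiv.measurableEmbedding.lintegral_map f).symm
  rw [h2, h1, lintegral_smul_measure, smul_eq_mul]
  congr 2
  simp [Real.rpow_neg]

/-- Multiplication by a unimodular function. -/
def mulUnit (m : Rn n → ℂ) (hm : Continuous m) (h1 : ∀ x, ‖m x‖ = 1) : L2 n →ₗᵢ[ℂ] L2 n :=
  weightedComp m id hm.aestronglyMeasurable (Measure.QuasiMeasurePreserving.id _) fun f =>
    eLpNorm_congr_norm_ae (Eventually.of_forall fun x => by simp [h1])

theorem mulUnit_ae (m : Rn n → ℂ) (hm : Continuous m) (h1 : ∀ x, ‖m x‖ = 1) (f : L2 n) :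
    mulUnit m hm h1 f =ᵐ[volume] fun x => m x * f x :=
  weightedComp_ae ..

/-- The translation `f ↦ f(· + h)`. -/
def translateL2 (h : Rn n) : L2 n →ₗᵢ[ℂ] L2 n :=
  weightedComp (fun _ => 1) (fun x => x + h) aestronglyMeasurable_const
    (measurePreserving_add_right _ h).quasiMeasurePreserving fun f => by
      simp only [one_mul]
      exact eLpNorm_comp_measurePreserving (Lp.aestronglyMeasurable f)
        (measurePreserving_add_right volume h)

theorem translateL2_ae (h : Rn n) (f : L2 n) :
    translateL2 h f =ᵐ[volume] fun x => f (x + h) :=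
  (weightedComp_ae ..).trans (by simp only [one_mul]; rfl)

/-- The dilation `f ↦ |s|^{n/2} f(s ·)`. -/
def dilateL2 (s : ℝ) (hs : s ≠ 0) : L2 n →ₗᵢ[ℂ] L2 n :=
  weightedComp (fun _ => ((|s| ^ ((n : ℝ) / 2) : ℝ) : ℂ)) (fun x => s • x)
    aestronglyMeasurable_const (quasiMeasurePreserving_smul_volume hs) fun f => by
      rw [eLpNorm_eq_lintegral_rpow_enorm_toReal (by norm_num) (by norm_num),
        eLpNorm_eq_lintegral_rpow_enorm_toReal (by norm_num) (by norm_num)]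
      congr 1
      have hs' : 0 < |s| := abs_pos.mpr hs
      simp only [enorm_mul, ENNReal.toReal_ofNat]
      simp_rw [ENNReal.mul_rpow_of_nonneg _ _ (zero_le_two : (0 : ℝ) ≤ 2)]
      rw [lintegral_const_mul' _ _ (by simp),
        lintegral_comp_smul' (fun x => ‖f x‖ₑ ^ (2 : ℝ)) hs, ← mul_assoc]
      convert one_mul _ using 2
      rw [← ofReal_norm, ENNReal.ofReal_rpow_of_nonneg (norm_nonneg _) zero_le_two,
        ← ENNReal.ofReal_mul (by positivity), Complex.norm_real, Real.norm_of_nonneg (by positivity),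
        ← Real.rpow_mul hs'.le, ← Real.rpow_add hs']
      simp

theorem dilateL2_ae (s : ℝ) (hs : s ≠ 0) (f : L2 n) :
    dilateL2 s hs f =ᵐ[volume] fun x => ((|s| ^ ((n : ℝ) / 2) : ℝ) : ℂ) * f (s • x) :=
  weightedComp_ae ..

theorem dilateL2_dilateL2_inv (s : ℝ) (hs : s ≠ 0) (f : L2 n) :
    dilateL2 s hs (dilateL2 s⁻¹ (inv_ne_zero hs) f) = f := by
  apply Lp.ext
  filter_upwards [dilateL2_ae s hs (dilateL2 s⁻¹ (inv_ne_zero hs) f),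
    (quasiMeasurePreserving_smul_volume hs).ae (dilateL2_ae s⁻¹ (inv_ne_zero hs) f)] with x h1 h2
  have hs' : 0 < |s| := abs_pos.mpr hs
  rw [h1, h2, smul_smul, inv_mul_cancel₀ hs, one_smul, ← mul_assoc, ← Complex.ofReal_mul,
    ← Real.mul_rpow (abs_nonneg _) (abs_nonneg _), ← abs_mul, mul_inv_cancel₀ hs]
  simp

/-! ### Translations and dilations under the Fourier transform. -/

/-- Two continuous maps on `L²` agree if they agree on Schwartz functions. -/
theorem L2.ext_schwartz {S S' : L2 n → L2 n} (hS : Continuous S) (hS' : Continuous S')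
    (h : ∀ φ : 𝓢(Rn n, ℂ), S (φ.toLp 2) = S' (φ.toLp 2)) (f : L2 n) : S f = S' f := by
  refine DenseRange.induction_on (p := fun f => S f = S' f)
    (SchwartzMap.denseRange_toLpCLM (E := Rn n) (F := ℂ) (p := 2) (μ := volume)
      ENNReal.ofNat_ne_top) f (isClosed_eq hS hS') h

theorem continuous_fourier_L2 : Continuous (fun f : L2 n => (𝓕 f : L2 n)) :=
  (Lp.fourierTransformₗᵢ (Rn n) ℂ).continuous

theorem continuous_fourierInv_L2 : Continuous (fun f : L2 n => (𝓕⁻ f : L2 n)) :=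
  (Lp.fourierTransformₗᵢ (Rn n) ℂ).symm.continuous

theorem fourier_schwartz_ae (φ : 𝓢(Rn n, ℂ)) :
    (𝓕 (φ.toLp 2 : L2 n) : L2 n) =ᵐ[volume] 𝓕 (φ : Rn n → ℂ) := by
  rw [SchwartzMap.toLp_fourier_eq]
  exact (SchwartzMap.coeFn_toLp (𝓕 φ) 2 volume).trans (by rw [SchwartzMap.fourier_coe])

theorem fourier_ae_of_ae_eq (f : L2 n) {g : Rn n → ℂ} (hg : Integrable g volume)
    (h : f =ᵐ[volume] g) : (𝓕 f : L2 n) =ᵐ[volume] 𝓕 g :=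
  (fourier_ae_eq_of_integrable f (hg.congr h.symm)).trans
    (Eventually.of_forall fun x => Real.fourier_congr_ae h x)

/-- The character `ξ ↦ e^{2πi h·ξ}`. -/
def character (h ξ : Rn n) : ℂ := Complex.exp (((2 * Real.pi * inner ℝ h ξ : ℝ) : ℂ) * Complex.I)

theorem continuous_character (h : Rn n) : Continuous (character h) := by
  unfold character; fun_prop

theorem norm_character (h ξ : Rn n) : ‖character h ξ‖ = 1 :=
  Complex.norm_exp_ofReal_mul_I _

theorem fourier_translateL2 (h : Rn n) (f : L2 n) :
    (𝓕 (translateL2 h f) : L2 n) =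
      mulUnit (character h) (continuous_character h) (norm_character h) (𝓕 f) := by
  refine L2.ext_schwartz (S := fun f => 𝓕 (translateL2 h f)) (S' := fun f =>
    mulUnit (character h) (continuous_character h) (norm_character h) (𝓕 f))
    (continuous_fourier_L2.comp (translateL2 h).continuous)
    ((LinearIsometry.continuous _).comp continuous_fourier_L2) (fun φ => ?_) f
  have h1 : translateL2 h (φ.toLp 2) =ᵐ[volume] fun x => φ (x + h) :=
    (translateL2_ae h _).trans ((measurePreserving_add_right volume h).quasiMeasurePreserving.ae
      (SchwartzMap.coeFn_toLp φ 2 volume))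
  apply Lp.ext
  filter_upwards [fourier_ae_of_ae_eq _ (φ.integrable.comp_add_right h) h1,
    mulUnit_ae (character h) (continuous_character h) (norm_character h) (𝓕 (φ.toLp 2)),
    fourier_schwartz_ae φ] with ξ h2 h3 h4
  rw [h2, h3, h4]
  have := congrFun (VectorFourier.fourierIntegral_comp_add_right Real.fourierChar volume
    (innerₗ (Rn n)) (φ : Rn n → ℂ) h) ξ
  refine this.trans ?_
  rw [Circle.smul_def, smul_eq_mul, Real.fourierChar_apply, character]
  rfl

theorem fourier_dilateL2 (s : ℝ) (hs : s ≠ 0) (f : L2 n) :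
    (𝓕 (dilateL2 s hs f) : L2 n) = dilateL2 s⁻¹ (inv_ne_zero hs) (𝓕 f) := by
  refine L2.ext_schwartz (S := fun f => 𝓕 (dilateL2 s hs f)) (S' := fun f =>
    dilateL2 s⁻¹ (inv_ne_zero hs) (𝓕 f))
    (continuous_fourier_L2.comp (dilateL2 s hs).continuous)
    ((LinearIsometry.continuous _).comp continuous_fourier_L2) (fun φ => ?_) f
  have hs' : 0 < |s| := abs_pos.mpr hs
  have h1 : dilateL2 s hs (φ.toLp 2) =ᵐ[volume]
      fun x => ((|s| ^ ((n : ℝ) / 2) : ℝ) : ℂ) * φ (s • x) := by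
    filter_upwards [dilateL2_ae s hs (φ.toLp 2), (quasiMeasurePreserving_smul_volume hs).ae
      (SchwartzMap.coeFn_toLp φ 2 volume)] with x h1 h2
    rw [h1, h2]
  apply Lp.ext
  filter_upwards [fourier_ae_of_ae_eq _ ((φ.integrable.comp_smul hs).const_mul _) h1,
    dilateL2_ae s⁻¹ (inv_ne_zero hs) (𝓕 (φ.toLp 2)),
    (quasiMeasurePreserving_smul_volume (inv_ne_zero hs)).ae (fourier_schwartz_ae φ)]
    with ξ h2 h3 h4
  rw [h2, h3, h4, Real.fourier_eq, Real.fourier_eq]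
  have e : ∀ v : Rn n, Real.fourierChar (-inner ℝ v ξ) •
      (((|s| ^ ((n : ℝ) / 2) : ℝ) : ℂ) * φ (s • v)) = ((|s| ^ ((n : ℝ) / 2) : ℝ) : ℂ) *
        (fun w : Rn n => Real.fourierChar (-inner ℝ w (s⁻¹ • ξ)) • φ w) (s • v) := by
    intro v
    have : inner ℝ (s • v) (s⁻¹ • ξ) = inner ℝ v ξ := by
      rw [real_inner_smul_left, real_inner_smul_right]; field_simp
    simp only [this, mul_smul_comm]
  rw [integral_congr_ae (Eventually.of_forall e), integral_const_mul,
    Measure.integral_comp_smul volume (fun w : Rn n => Real.fourierChar (-inner ℝ w (s⁻¹ • ξ)) • φ w),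
    finrank_euclideanSpace_fin, Complex.real_smul, ← mul_assoc, ← Complex.ofReal_mul]
  congr 2
  rw [abs_inv, abs_inv, abs_pow, Real.inv_rpow hs'.le, ← Real.rpow_natCast, ← Real.rpow_neg hs'.le,
    ← Real.rpow_add hs', ← Real.rpow_neg hs'.le]
  congr 1; ring

/-! ### The Fresnel representation of the free Schrödinger evolution -/

/-- Damped Gaussians against a Fourier transform. -/
theorem integral_gaussian_mul_fourier (φ : 𝓢(Rn n, ℂ)) {b : ℂ} (hb : 0 < b.re) (x : Rn n) :
    ∫ ξ, Complex.exp (-b * ‖ξ‖ ^ 2 + 2 * Real.pi * Complex.I * inner ℝ x ξ) * 𝓕 (φ : Rn n → ℂ) ξ =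
      (Real.pi / b) ^ ((n : ℂ) / 2) *
        ∫ y, Complex.exp (-Real.pi ^ 2 * ‖x - y‖ ^ 2 / b) * φ y := by
  have hint : Integrable (fun ξ : Rn n =>
      Complex.exp (-b * ‖ξ‖ ^ 2 + 2 * Real.pi * Complex.I * inner ℝ x ξ)) :=
    GaussianFourier.integrable_cexp_neg_mul_sq_norm_add hb _ _
  have h := VectorFourier.integral_fourierIntegral_smul_eq_flip (L := innerₗ (Rn n))
    Real.continuous_fourierChar continuous_inner hint (φ.integrable (μ := volume))
  rw [flip_innerₗ] at h
  rw [← integral_const_mul]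
  refine Eq.trans ?_ (h.symm.trans ?_)
  · rfl
  · refine integral_congr_ae (Eventually.of_forall fun y => ?_)
    have h2 := fourier_gaussian_innerProductSpace' hb x y
    simp only [finrank_euclideanSpace_fin] at h2
    simp only [smul_eq_mul, ← mul_assoc, ← h2]
    rfl

theorem fourierInv_evolved_schwartz (φ : 𝓢(Rn n, ℂ)) {T : ℝ} (hT : T ≠ 0) (x : Rn n) :
    𝓕⁻ (fun ξ : Rn n => Complex.exp (((-Real.pi * T * ‖ξ‖ ^ 2 : ℝ) : ℂ) * Complex.I) *
      𝓕 (φ : Rn n → ℂ) ξ) x =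
      (1 / (Complex.I * T)) ^ ((n : ℂ) / 2) *
        ∫ y, Complex.exp (((Real.pi * ‖x - y‖ ^ 2 / T : ℝ) : ℂ) * Complex.I) * φ y := by
  have hpi : (Real.pi : ℂ) ≠ 0 := by exact_mod_cast Real.pi_ne_zero
  have hT' : (T : ℂ) ≠ 0 := by exact_mod_cast hT
  -- The oscillating Gaussian is not integrable. Damping by ε > 0 makes the Gaussian transform
  -- formula available; both sides then pass to ε → 0 by dominated convergence.
  set b : ℝ → ℂ := fun ε => Real.pi * (ε + Complex.I * T) with hb
  have hb_re : ∀ ε, (b ε).re = Real.pi * ε := fun ε => by simp [hb]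
  have hb0 : b 0 ≠ 0 := by simp [hb, hpi, hT']
  have hbc : Continuous b := by fun_prop
  have hF : Integrable (𝓕 (φ : Rn n → ℂ)) := by
    rw [← SchwartzMap.fourier_coe]; exact (𝓕 φ).integrable
  have hbt : Tendsto b (𝓝[>] 0) (𝓝 (b 0)) := (hbc.tendsto 0).mono_left nhdsWithin_le_nhds
  have h1 : Tendsto (fun ε => ∫ ξ : Rn n, Complex.exp (-b ε * ‖ξ‖ ^ 2 +
      2 * Real.pi * Complex.I * inner ℝ x ξ) * 𝓕 (φ : Rn n → ℂ) ξ) (𝓝[>] 0)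
      (𝓝 (∫ ξ : Rn n, Complex.exp (-b 0 * ‖ξ‖ ^ 2 +
      2 * Real.pi * Complex.I * inner ℝ x ξ) * 𝓕 (φ : Rn n → ℂ) ξ)) := by
    refine tendsto_integral_filter_of_dominated_convergence (fun ξ => ‖𝓕 (φ : Rn n → ℂ) ξ‖)
      (Eventually.of_forall fun ε => ?_) ?_ hF.norm (Eventually.of_forall fun ξ => ?_)
    · exact (Continuous.aestronglyMeasurable (by fun_prop)).mul hF.1
    · filter_upwards [self_mem_nhdsWithin] with ε hε
      refine Eventually.of_forall fun ξ => ?_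
      rw [norm_mul, Complex.norm_exp]
      refine mul_le_of_le_one_left (norm_nonneg _) (Real.exp_le_one_iff.mpr ?_)
      have e1 : (-b ε * (‖ξ‖ : ℂ) ^ 2 + 2 * Real.pi * Complex.I * inner ℝ x ξ).re =
          -(b ε).re * ‖ξ‖ ^ 2 := by
        rw [← Complex.ofReal_pow]
        simp only [Complex.add_re, Complex.mul_re, Complex.ofReal_re, Complex.ofReal_im]
        simp
      rw [e1, hb_re]
      have : 0 < ε := hε
      have : 0 ≤ Real.pi * ε * ‖ξ‖ ^ 2 := by positivity
      linarith
    · refine Tendsto.mul_const _ ((Complex.continuous_exp.tendsto _).comp ?_)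
      exact (hbt.neg.mul_const _).add_const _
  have h2 : Tendsto (fun ε => (Real.pi / b ε) ^ ((n : ℂ) / 2) *
        ∫ y, Complex.exp (-Real.pi ^ 2 * ‖x - y‖ ^ 2 / b ε) * φ y) (𝓝[>] 0)
      (𝓝 ((Real.pi / b 0) ^ ((n : ℂ) / 2) *
        ∫ y, Complex.exp (-Real.pi ^ 2 * ‖x - y‖ ^ 2 / b 0) * φ y)) := by
    refine Tendsto.mul ?_ ?_
    · refine (tendsto_const_nhds.div hbt hb0).cpow tendsto_const_nhds ?_
      -- Here π / b 0 = -i/T has nonzero imaginary part, hence avoids the branch cut of the power.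
      right
      have : (Real.pi : ℂ) / b 0 = ((-1 / T : ℝ) : ℂ) * Complex.I := by
        simp only [hb]; push_cast; field_simp
        simp [← mul_assoc]
      rw [this]
      simp [hT]
    · refine tendsto_integral_filter_of_dominated_convergence (fun y => ‖φ y‖)
        (Eventually.of_forall fun ε => ?_) ?_ φ.integrable.norm (Eventually.of_forall fun ξ => ?_)
      · exact (Continuous.aestronglyMeasurable (by fun_prop)).mul φ.integrable.1
      · filter_upwards [self_mem_nhdsWithin] with ε hε
        refine Eventually.of_forall fun y => ?_
        rw [norm_mul, Complex.norm_exp]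
        refine mul_le_of_le_one_left (norm_nonneg _) (Real.exp_le_one_iff.mpr ?_)
        have e1 : -(Real.pi : ℂ) ^ 2 * (‖x - y‖ : ℂ) ^ 2 / b ε =
            ((-(Real.pi ^ 2 * ‖x - y‖ ^ 2) : ℝ) : ℂ) * (b ε)⁻¹ := by
          push_cast; rw [div_eq_mul_inv]; ring
        rw [e1, Complex.re_ofReal_mul, Complex.inv_re, hb_re]
        have h0 : 0 < ε := hε
        have : 0 ≤ (Real.pi ^ 2 * ‖x - y‖ ^ 2) * (Real.pi * ε / Complex.normSq (b ε)) := by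
          have := Complex.normSq_nonneg (b ε)
          positivity
        linarith
      · refine Tendsto.mul_const _ ((Complex.continuous_exp.tendsto _).comp ?_)
        exact tendsto_const_nhds.div hbt hb0
  have h3 := tendsto_nhds_unique (h1.congr' (by
    filter_upwards [self_mem_nhdsWithin] with ε hε
    have h0 : 0 < ε := hε
    exact integral_gaussian_mul_fourier φ (by rw [hb_re]; positivity) x)) h2
  have e0 : (Real.pi : ℂ) / b 0 = 1 / (Complex.I * T) := by
    simp only [hb]; push_cast; field_simp; simp
  rw [e0] at h3
  refine Eq.trans ?_ (h3.trans ?_)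
  · rw [Real.fourierInv_eq']
    refine integral_congr_ae (Eventually.of_forall fun ξ => ?_)
    simp only [smul_eq_mul]
    rw [← mul_assoc, ← Complex.exp_add, real_inner_comm]
    congr 2
    simp only [hb]; push_cast; ring
  · congr 1
    refine integral_congr_ae (Eventually.of_forall fun y => ?_)
    simp only
    congr 2
    simp only [hb]; push_cast; field_simp
    linear_combination (-((‖x - y‖ : ℂ) ^ 2 * T)) * Complex.I_sq

/-- The chirp `e^{πi|x|²/T}`. -/
def chirp (T : ℝ) (x : Rn n) : ℂ := Complex.exp (((Real.pi * ‖x‖ ^ 2 / T : ℝ) : ℂ) * Complex.I)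

theorem continuous_chirp (T : ℝ) : Continuous (chirp T : Rn n → ℂ) := by
  unfold chirp; fun_prop

theorem norm_chirp (T : ℝ) (x : Rn n) : ‖chirp T x‖ = 1 := Complex.norm_exp_ofReal_mul_I _

/-- Multiplication by the chirp `e^{πi|x|²/T}` on `L²`. -/
def chirpL2 (T : ℝ) : L2 n →ₗᵢ[ℂ] L2 n := mulUnit (chirp T) (continuous_chirp T) (norm_chirp T)

theorem chirpL2_ae (T : ℝ) (f : L2 n) : chirpL2 T f =ᵐ[volume] fun x => chirp T x * f x :=
  mulUnit_ae ..

theorem schrodinger_eq_fourierInv_mulUnit (f : L2 n) (t : ℝ) :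
    schrodinger f t = 𝓕⁻ (mulUnit (fun ξ : Rn n =>
      Complex.exp (((-Real.pi * t * ‖ξ‖ ^ 2 : ℝ) : ℂ) * Complex.I)) (by fun_prop)
      (fun _ => Complex.norm_exp_ofReal_mul_I _) (𝓕 f)) := by
  rw [schrodinger]
  congr 1

/-- The unimodular constant of the Fresnel representation. -/
def fresnelConst (n : ℕ) (T : ℝ) : ℂ :=
  (1 / (Complex.I * T)) ^ ((n : ℂ) / 2) * ((|T| ^ ((n : ℝ) / 2) : ℝ) : ℂ)

theorem norm_fresnelConst {T : ℝ} (hT : T ≠ 0) : ‖fresnelConst n T‖ = 1 := by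
  have hT' : 0 < |T| := abs_pos.mpr hT
  have h0 : 1 / (Complex.I * (T : ℂ)) ≠ 0 := by simp [hT]
  have e : ((n : ℂ) / 2) = (((n : ℝ) / 2 : ℝ) : ℂ) := by push_cast; rfl
  rw [fresnelConst, norm_mul, Complex.norm_real, Real.norm_of_nonneg (by positivity), e,
    Complex.norm_cpow_real]
  simp only [norm_div, norm_one, norm_mul, Complex.norm_I, one_mul, Complex.norm_real,
    Real.norm_eq_abs]
  rw [← Real.mul_rpow (by positivity) (by positivity)]
  simp [hT]

/-- Both sides are continuous in `f`, so the integral kernel formula for Schwartz data suffices. The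
square |x-y|² splits into two chirps and the Fourier kernel at x/T. -/
theorem schrodinger_eq_fresnel (f : L2 n) {T : ℝ} (hT : T ≠ 0) :
    schrodinger f T = fresnelConst n T •
      chirpL2 T (dilateL2 T⁻¹ (inv_ne_zero hT) (𝓕 (chirpL2 T f))) := by
  refine L2.ext_schwartz (S := fun f => schrodinger f T) (S' := fun f => fresnelConst n T •
      chirpL2 T (dilateL2 T⁻¹ (inv_ne_zero hT) (𝓕 (chirpL2 T f)))) ?_ ?_ (fun φ => ?_) f
  · simp only [schrodinger_eq_fourierInv_mulUnit]
    exact continuous_fourierInv_L2.comp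
      ((LinearIsometry.continuous _).comp continuous_fourier_L2)
  · have hc : Continuous fun f : L2 n =>
        chirpL2 T (dilateL2 T⁻¹ (inv_ne_zero hT) (𝓕 (chirpL2 T f))) :=
      ((chirpL2 (n := n) T).continuous.comp
      ((dilateL2 (n := n) T⁻¹ (inv_ne_zero hT)).continuous.comp
        (continuous_fourier_L2.comp (chirpL2 T).continuous)))
    exact hc.const_smul (fresnelConst n T)
  have hF : Integrable (𝓕 (φ : Rn n → ℂ)) := by
    rw [← SchwartzMap.fourier_coe]; exact (𝓕 φ).integrable
  apply Lp.ext
  have hev : (memLp_evolvedFourier (φ.toLp 2 volume) T).toLp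
      (evolvedFourier (φ.toLp 2 volume) T) =ᵐ[volume] fun ξ : Rn n =>
        Complex.exp (((-Real.pi * T * ‖ξ‖ ^ 2 : ℝ) : ℂ) * Complex.I) * 𝓕 (φ : Rn n → ℂ) ξ := by
    filter_upwards [(memLp_evolvedFourier (φ.toLp 2 volume) T).coeFn_toLp,
      fourier_schwartz_ae φ] with ξ h1 h2
    rw [h1, evolvedFourier, h2]
  have hint : Integrable (fun ξ : Rn n =>
        Complex.exp (((-Real.pi * T * ‖ξ‖ ^ 2 : ℝ) : ℂ) * Complex.I) * 𝓕 (φ : Rn n → ℂ) ξ) :=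
    hF.mono ((Continuous.aestronglyMeasurable (by fun_prop)).mul hF.1)
      (Eventually.of_forall fun ξ => by rw [norm_mul, Complex.norm_exp_ofReal_mul_I, one_mul])
  have hchirp : chirpL2 T (φ.toLp 2 volume) =ᵐ[volume] fun x : Rn n => chirp T x * φ x := by
    filter_upwards [chirpL2_ae T (φ.toLp 2 volume), SchwartzMap.coeFn_toLp φ 2 volume]
      with x h1 h2
    rw [h1, h2]
  have hchirp_int : Integrable (fun x : Rn n => chirp T x * φ x) :=
    φ.integrable.mono ((continuous_chirp T).aestronglyMeasurable.mul φ.integrable.1)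
      (Eventually.of_forall fun ξ => by rw [norm_mul, norm_chirp, one_mul])
  filter_upwards [fourierInv_ae_eq_of_integrable _ (hint.congr hev.symm),
    Lp.coeFn_smul (fresnelConst n T) (chirpL2 T (dilateL2 T⁻¹ (inv_ne_zero hT)
      (𝓕 (chirpL2 T (φ.toLp 2 volume))))),
    chirpL2_ae T (dilateL2 T⁻¹ (inv_ne_zero hT) (𝓕 (chirpL2 T (φ.toLp 2 volume)))),
    dilateL2_ae T⁻¹ (inv_ne_zero hT) (𝓕 (chirpL2 T (φ.toLp 2 volume))),
    (quasiMeasurePreserving_smul_volume (inv_ne_zero hT)).ae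
      (fourier_ae_of_ae_eq _ hchirp_int hchirp)] with x h1 h2 h3 h4 h5
  have hT' : 0 < |T| := abs_pos.mpr hT
  rw [h2, Pi.smul_apply, h3, h4, h5, schrodinger, h1, Real.fourierInv_congr_ae hev,
    fourierInv_evolved_schwartz φ hT, fresnelConst, Real.fourier_eq', smul_eq_mul]
  -- The factor |T|^{n/2} in `fresnelConst` compensates the normalization of the dilation.
  have e1 : ((|T| ^ ((n : ℝ) / 2) : ℝ) : ℂ) * ((|T⁻¹| ^ ((n : ℝ) / 2) : ℝ) : ℂ) = 1 := by
    rw [← Complex.ofReal_mul, ← Real.mul_rpow (abs_nonneg _) (abs_nonneg _), ← abs_mul,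
      mul_inv_cancel₀ hT]
    simp
  have e2 : ∫ y, Complex.exp (((Real.pi * ‖x - y‖ ^ 2 / T : ℝ) : ℂ) * Complex.I) * φ y =
      chirp T x * ∫ y, Complex.exp (((-2 * Real.pi * inner ℝ y (T⁻¹ • x) : ℝ) : ℂ) * Complex.I) •
        (chirp T y * φ y) := by
    rw [← integral_const_mul]
    refine integral_congr_ae (Eventually.of_forall fun y => ?_)
    simp only [chirp, smul_eq_mul]
    rw [← mul_assoc, ← mul_assoc, ← Complex.exp_add, ← Complex.exp_add]
    congr 2
    rw [← add_mul, ← add_mul, ← Complex.ofReal_add, ← Complex.ofReal_add]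
    congr 2
    rw [norm_sub_sq_real, real_inner_smul_right, real_inner_comm]
    field_simp
    ring
  rw [e2]
  linear_combination (-((1 / (Complex.I * (T : ℂ))) ^ ((n : ℂ) / 2) * chirp T x *
    ∫ y, Complex.exp (((-2 * Real.pi * inner ℝ y (T⁻¹ • x) : ℝ) : ℂ) * Complex.I) •
        (chirp T y * φ y))) * e1

variable {δ : ℝ}

/-! ### Moments -/

/-- The moment `∫ |x|^{2δ} |f(x)|² dx`. -/
def moment (δ : ℝ) (f : Rn n → ℂ) : ℝ≥0∞ :=
  ∫⁻ x, ENNReal.ofReal (‖x‖ ^ (2 * δ) * ‖f x‖ ^ 2)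

theorem hDelta_eq_moment (δ : ℝ) (f : L2 n) (t : ℝ) : hDelta δ f t = moment δ (schrodinger f t) :=
  rfl

theorem L2.measurable (f : L2 n) : Measurable f := (Lp.stronglyMeasurable f).measurable

theorem measurable_moment_integrand (δ : ℝ) (f : L2 n) :
    Measurable fun x => ENNReal.ofReal (‖x‖ ^ (2 * δ) * ‖f x‖ ^ 2) := by
  have := L2.measurable f
  fun_prop

theorem lintegral_norm_sq (f : L2 n) :
    ∫⁻ x, ENNReal.ofReal (‖f x‖ ^ 2) = ENNReal.ofReal (‖f‖ ^ 2) := by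
  have h := eLpNorm_nnreal_pow_eq_lintegral (f := f) (μ := volume) (p := 2) (by norm_num)
  have h2 : ENNReal.ofReal (‖f‖ ^ 2) = eLpNorm f 2 volume ^ 2 := by
    rw [ENNReal.ofReal_pow (norm_nonneg _), Lp.norm_def, ENNReal.ofReal_toReal (Lp.memLp f).2.ne]
  rw [h2]
  have h3 : eLpNorm f 2 volume ^ 2 = eLpNorm f ((2 : NNReal) : ℝ≥0∞) volume ^ ((2 : NNReal) : ℝ) := by
    norm_num
  rw [h3, h]
  refine lintegral_congr fun x => ?_
  rw [ENNReal.ofReal_pow (norm_nonneg _), ofReal_norm]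
  norm_num

theorem moment_mono_ae {f g : Rn n → ℂ} (h : ∀ᵐ x, ‖f x‖ ≤ ‖g x‖) : moment δ f ≤ moment δ g := by
  refine lintegral_mono_ae ?_
  filter_upwards [h] with x hx
  gcongr

theorem moment_congr_norm_ae {f g : Rn n → ℂ} (h : ∀ᵐ x, ‖f x‖ = ‖g x‖) :
    moment δ f = moment δ g :=
  le_antisymm (moment_mono_ae (h.mono fun _ hx => hx.le))
    (moment_mono_ae (h.mono fun _ hx => hx.ge))

theorem moment_const_mul (c : ℂ) (f : Rn n → ℂ) :
    moment δ (fun x => c * f x) = ENNReal.ofReal (‖c‖ ^ 2) * moment δ f := by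
  rw [moment, moment, ← lintegral_const_mul' _ _ ENNReal.ofReal_ne_top]
  refine lintegral_congr fun x => ?_
  rw [← ENNReal.ofReal_mul (by positivity), norm_mul]
  congr 1; ring

theorem moment_smul (c : ℂ) (f : L2 n) :
    moment δ (c • f : L2 n) = ENNReal.ofReal (‖c‖ ^ 2) * moment δ f := by
  rw [← moment_const_mul]
  refine moment_congr_norm_ae ?_
  filter_upwards [Lp.coeFn_smul c f] with x hx
  rw [hx, Pi.smul_apply, smul_eq_mul]

/-- The parallelogram law holds pointwise; it is stated additively so that infinite moments are
allowed. -/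
theorem moment_parallelogram (f g : L2 n) :
    moment δ (f + g : L2 n) + moment δ (f - g : L2 n) = 2 * (moment δ f + moment δ g) := by
  simp only [moment]
  rw [← lintegral_add_left (measurable_moment_integrand δ _),
    ← lintegral_add_left (measurable_moment_integrand δ _),
    ← lintegral_const_mul' _ _ (by norm_num)]
  refine lintegral_congr_ae ?_
  filter_upwards [Lp.coeFn_add f g, Lp.coeFn_sub f g] with x h1 h2
  rw [h1, h2, Pi.add_apply, Pi.sub_apply, ← ENNReal.ofReal_add (by positivity) (by positivity),
    ← ENNReal.ofReal_add (by positivity) (by positivity),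
    two_mul (ENNReal.ofReal _), ← ENNReal.ofReal_add (by positivity) (by positivity)]
  congr 1
  have := parallelogram_law_with_norm ℝ (f x) (g x)
  linear_combination ‖x‖ ^ (2 * δ) * this

theorem moment_dilateL2 {s : ℝ} (hs : s ≠ 0) (f : L2 n) :
    moment δ (dilateL2 s hs f) = ENNReal.ofReal (|s| ^ (-(2 * δ))) * moment δ f := by
  have hs' : 0 < |s| := abs_pos.mpr hs
  have h1 : moment δ (dilateL2 s hs f) = ENNReal.ofReal (|s| ^ ((n : ℝ) - 2 * δ)) *
      ∫⁻ x, ENNReal.ofReal (‖s • x‖ ^ (2 * δ) * ‖f (s • x)‖ ^ 2) := by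
    rw [moment, ← lintegral_const_mul' _ _ ENNReal.ofReal_ne_top]
    refine lintegral_congr_ae ?_
    filter_upwards [dilateL2_ae s hs f] with x hx
    rw [hx, ← ENNReal.ofReal_mul (by positivity), norm_mul, Complex.norm_real,
      Real.norm_of_nonneg (by positivity), norm_smul, Real.norm_eq_abs,
      Real.mul_rpow hs'.le (norm_nonneg _), mul_pow, ← Real.rpow_natCast (|s| ^ _),
      ← Real.rpow_mul hs'.le, sub_eq_add_neg, Real.rpow_add hs', Real.rpow_neg hs'.le]
    have : |s| ^ (2 * δ) ≠ 0 := by positivity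
    congr 1
    rw [show (n : ℝ) / 2 * (2 : ℕ) = n by push_cast; ring]
    field_simp
  rw [h1, lintegral_comp_smul' (fun x => ENNReal.ofReal (‖x‖ ^ (2 * δ) * ‖f x‖ ^ 2)) hs,
    ← mul_assoc, ← ENNReal.ofReal_mul (by positivity), ← Real.rpow_add hs', moment]
  congr 3; ring

theorem moment_eq_zero_iff (hn : 0 < n) (f : L2 n) : moment δ f = 0 ↔ f = 0 := by
  have : Nonempty (Fin n) := ⟨⟨0, hn⟩⟩
  rw [moment, lintegral_eq_zero_iff (measurable_moment_integrand δ f), Lp.eq_zero_iff_ae_eq_zero]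
  have h0 : ∀ᵐ x : Rn n, x ≠ 0 := by
    simp [ae_iff]
  constructor
  · intro h
    filter_upwards [h, h0] with x hx hx0
    have h1 : 0 < ‖x‖ ^ (2 * δ) := Real.rpow_pos_of_pos (norm_pos_iff.mpr hx0) _
    have h2 := ENNReal.ofReal_eq_zero.mp hx
    by_contra h3
    have h4 : 0 < ‖f x‖ ^ 2 := pow_pos (norm_pos_iff.mpr h3) 2
    exact absurd h2 (not_le.mpr (mul_pos h1 h4))
  · intro h
    filter_upwards [h] with x hx
    simp [hx]

theorem eLpNorm_weight_sq (g : Rn n → ℂ) :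
    eLpNorm (fun x => ((‖x‖ ^ δ : ℝ) : ℂ) * g x) 2 volume ^ 2 = moment δ g := by
  have h := eLpNorm_nnreal_pow_eq_lintegral (f := fun x => ((‖x‖ ^ δ : ℝ) : ℂ) * g x)
    (μ := volume) (p := 2) (by norm_num)
  have h3 : ∀ a : ℝ≥0∞, a ^ 2 = a ^ ((2 : NNReal) : ℝ) := by intro a; norm_num
  rw [h3]
  refine Eq.trans h ?_
  refine lintegral_congr fun x => ?_
  rw [← h3, ← ofReal_norm, ← ENNReal.ofReal_pow (norm_nonneg _), norm_mul, mul_pow,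
    Complex.norm_real, Real.norm_of_nonneg (by positivity), ← Real.rpow_natCast (‖x‖ ^ δ),
    ← Real.rpow_mul (norm_nonneg _)]
  rw [show δ * (2 : ℕ) = 2 * δ by push_cast; ring]

theorem aestronglyMeasurable_weight (g : L2 n) :
    AEStronglyMeasurable (fun x => ((‖x‖ ^ δ : ℝ) : ℂ) * g x) volume := by
  have := L2.measurable g
  exact Measurable.aestronglyMeasurable (by fun_prop)

theorem memLp_weight_iff (g : L2 n) :
    MemLp (fun x => ((‖x‖ ^ δ : ℝ) : ℂ) * g x) 2 volume ↔ moment δ g < ⊤ := by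
  rw [← eLpNorm_weight_sq]
  constructor
  · intro h; exact ENNReal.pow_lt_top h.2
  · intro h
    exact ⟨aestronglyMeasurable_weight g, lt_of_not_ge fun h' => by
      rw [top_le_iff.mp h'] at h; simp at h⟩

theorem memSigma_iff (f : L2 n) :
    MemSigma δ f ↔ moment δ f < ⊤ ∧ moment δ (𝓕 f : L2 n) < ⊤ :=
  and_congr (memLp_weight_iff f) (memLp_weight_iff _)

theorem weightNorm_sq (f : L2 n) : weightNorm δ f ^ 2 = (moment δ f).toReal := by
  rw [weightNorm, ← ENNReal.toReal_pow, ← eLpNorm_weight_sq]; rfl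

theorem fracDerivNorm_sq (f : L2 n) :
    fracDerivNorm δ f ^ 2 = (moment δ (𝓕 f : L2 n)).toReal := by
  rw [fracDerivNorm, ← ENNReal.toReal_pow, ← eLpNorm_weight_sq]; rfl

theorem weightNorm_nonneg (f : L2 n) : 0 ≤ weightNorm δ f := ENNReal.toReal_nonneg

theorem fracDerivNorm_nonneg (f : L2 n) : 0 ≤ fracDerivNorm δ f := ENNReal.toReal_nonneg

theorem rpow_le_one_add_sq {r a : ℝ} (hr : 0 ≤ r) (ha : 0 ≤ a) (ha2 : a ≤ 2) :
    r ^ a ≤ 1 + r ^ 2 := by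
  rcases le_total r 1 with h | h
  · have := Real.rpow_le_one hr h ha
    nlinarith [sq_nonneg r]
  · have := Real.rpow_le_rpow_of_exponent_le h ha2
    rw [Real.rpow_two] at this
    linarith

theorem SchwartzMap.integrable_rpow_mul_norm (φ : 𝓢(Rn n, ℂ)) {a : ℝ} (ha : 0 ≤ a) (ha2 : a ≤ 2) :
    Integrable (fun x => ‖x‖ ^ a * ‖φ x‖) := by
  have hi : Integrable (fun x => (1 + ‖x‖ ^ 2) * ‖φ x‖) := by
    simp_rw [add_mul, one_mul]
    exact φ.integrable.norm.add (φ.integrable_pow_mul volume 2)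
  refine hi.mono' ?_ (Eventually.of_forall fun x => ?_)
  · exact Measurable.aestronglyMeasurable (by have := φ.continuous.measurable; fun_prop)
  · rw [Real.norm_of_nonneg (by positivity)]
    gcongr
    exact rpow_le_one_add_sq (norm_nonneg _) ha ha2

theorem moment_schwartz_lt_top (φ : 𝓢(Rn n, ℂ)) (hδ0 : 0 ≤ δ) (hδ1 : δ ≤ 1) :
    moment δ φ < ⊤ := by
  obtain ⟨C, hC⟩ := φ.decay 0 0
  have hi := (SchwartzMap.integrable_rpow_mul_norm φ (a := 2 * δ) (by linarith)
    (by linarith)).mul_const C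
  refine lt_of_le_of_lt (lintegral_mono fun x => ?_) hi.lintegral_lt_top
  refine ENNReal.ofReal_le_ofReal ?_
  have h1 := hC.2 x
  simp only [pow_zero, norm_iteratedFDeriv_zero, one_mul] at h1
  have h2 : 0 ≤ ‖x‖ ^ (2 * δ) * ‖φ x‖ := by positivity
  calc ‖x‖ ^ (2 * δ) * ‖φ x‖ ^ 2 = ‖x‖ ^ (2 * δ) * ‖φ x‖ * ‖φ x‖ := by ring
    _ ≤ _ := mul_le_mul_of_nonneg_left h1 h2

/-! ### The energy -/

/-- The quadratic form `∫ |x|^{2δ} |f|² + ∫ |ξ|^{2δ} |f̂|²`. -/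
def energy (δ : ℝ) (f : L2 n) : ℝ≥0∞ := moment δ f + moment δ (𝓕 f : L2 n)

theorem energy_smul (c : ℂ) (f : L2 n) :
    energy δ (c • f) = ENNReal.ofReal (‖c‖ ^ 2) * energy δ f := by
  rw [energy, energy, FourierTransform.fourier_smul, moment_smul, moment_smul, mul_add]

theorem fourier_sub_L2 (f g : L2 n) : (𝓕 (f - g) : L2 n) = 𝓕 f - 𝓕 g :=
  (Lp.fourierTransformₗᵢ (Rn n) ℂ).map_sub f g

theorem energy_parallelogram (f g : L2 n) :
    energy δ (f + g) + energy δ (f - g) = 2 * (energy δ f + energy δ g) := by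
  have h1 := moment_parallelogram (δ := δ) f g
  have h2 := moment_parallelogram (δ := δ) (𝓕 f) (𝓕 g)
  rw [← FourierTransform.fourier_add, ← fourier_sub_L2] at h2
  calc energy δ (f + g) + energy δ (f - g)
      = (moment δ (f + g : L2 n) + moment δ (f - g : L2 n)) +
        (moment δ (𝓕 (f + g) : L2 n) + moment δ (𝓕 (f - g) : L2 n)) := by
        simp only [energy]; ring
    _ = _ := by rw [h1, h2]; simp only [energy]; ring

theorem energy_schwartz_lt_top (φ : 𝓢(Rn n, ℂ)) (hδ0 : 0 ≤ δ) (hδ1 : δ ≤ 1) :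
    energy δ (φ.toLp 2 : L2 n) < ⊤ := by
  rw [energy, SchwartzMap.toLp_fourier_eq]
  have h : ∀ ψ : 𝓢(Rn n, ℂ), moment δ (ψ.toLp 2 : L2 n) = moment δ ψ := fun ψ =>
    moment_congr_norm_ae ((SchwartzMap.coeFn_toLp ψ 2 volume).mono fun x hx => by rw [hx])
  rw [h, h]
  exact ENNReal.add_lt_top.mpr
    ⟨moment_schwartz_lt_top φ hδ0 hδ1, moment_schwartz_lt_top _ hδ0 hδ1⟩

/-- The energy is lower semicontinuous along convergent sequences. -/
theorem energy_le_of_tendsto {u : ℕ → L2 n} {f : L2 n} (hu : Tendsto u atTop (𝓝 f)) {M : ℝ≥0∞}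
    (hM : Tendsto (fun j => energy δ (u j)) atTop (𝓝 M)) : energy δ f ≤ M := by
  -- Two successive extractions give almost everywhere convergence of both the functions and their
  -- transforms, after which Fatou applies to the sum of the two integrands.
  obtain ⟨ns, hns, hae⟩ := (tendstoInMeasure_of_tendsto_Lp hu).exists_seq_tendsto_ae
  have hF : Tendsto (fun j => (𝓕 (u (ns j)) : L2 n)) atTop (𝓝 (𝓕 f)) :=
    ((continuous_fourier_L2.tendsto f).comp hu).comp hns.tendsto_atTop
  obtain ⟨ms, hms, hae'⟩ := (tendstoInMeasure_of_tendsto_Lp hF).exists_seq_tendsto_ae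
  have hsum : ∀ g : L2 n, energy δ g = ∫⁻ x, (ENNReal.ofReal (‖x‖ ^ (2 * δ) * ‖g x‖ ^ 2) +
      ENNReal.ofReal (‖x‖ ^ (2 * δ) * ‖(𝓕 g : L2 n) x‖ ^ 2)) := fun g => by
    rw [lintegral_add_left (measurable_moment_integrand δ g)]; rfl
  have hlim : Tendsto (fun j => energy δ (u (ns (ms j)))) atTop (𝓝 M) :=
    hM.comp (hns.tendsto_atTop.comp hms.tendsto_atTop)
  rw [← hlim.liminf_eq, hsum]
  simp_rw [hsum]
  refine le_trans (lintegral_mono_ae ?_) (lintegral_liminf_le fun j =>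
    (measurable_moment_integrand δ _).add (measurable_moment_integrand δ _))
  filter_upwards [hae, hae'] with x h1 h2
  refine (Tendsto.liminf_eq ?_).ge
  refine Tendsto.add ?_ ?_
  · exact ENNReal.tendsto_ofReal
      ((((h1.comp hms.tendsto_atTop).norm).pow 2).const_mul _)
  · exact ENNReal.tendsto_ofReal (((h2.norm).pow 2).const_mul _)

/-! ### The Gagliardo double integral -/

/-- The kernel `|h|^{-(n+2δ)}`. -/
def gagliardoKernel (n : ℕ) (δ : ℝ) (h : Rn n) : ℝ := ‖h‖ ^ (-((n : ℝ) + 2 * δ))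

theorem gagliardoKernel_nonneg (h : Rn n) : 0 ≤ gagliardoKernel n δ h := by
  unfold gagliardoKernel; positivity

theorem gagliardoKernel_pos {h : Rn n} (hh : h ≠ 0) : 0 < gagliardoKernel n δ h :=
  Real.rpow_pos_of_pos (norm_pos_iff.mpr hh) _

theorem measurable_gagliardoKernel : Measurable (gagliardoKernel n δ) := by
  unfold gagliardoKernel; fun_prop

/-- The Gagliardo form `∬ |f(y) - f(x)|² |y - x|^{-(n+2δ)} dx dy`. -/
def gagliardo (δ : ℝ) (f : Rn n → ℂ) : ℝ≥0∞ :=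
  ∫⁻ x, ∫⁻ y, ENNReal.ofReal (‖f y - f x‖ ^ 2 * gagliardoKernel n δ (y - x))

/-- The symbol `∫ |e^{2πi h·ξ} - 1|² |h|^{-(n+2δ)} dh` of the Gagliardo form. -/
def gagliardoSymbol (δ : ℝ) (ξ : Rn n) : ℝ≥0∞ :=
  ∫⁻ h, ENNReal.ofReal (‖character h ξ - 1‖ ^ 2 * gagliardoKernel n δ h)

theorem measurable_character_prod :
    Measurable fun p : Rn n × Rn n => character p.1 p.2 := by
  unfold character; fun_prop

/-- Plancherel, since translation by h multiplies the transform by a character. -/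
theorem lintegral_norm_translate_sub_sq (h : Rn n) (f : L2 n) :
    ∫⁻ x, ENNReal.ofReal (‖f (x + h) - f x‖ ^ 2) =
      ∫⁻ ξ, ENNReal.ofReal (‖character h ξ - 1‖ ^ 2 * ‖(𝓕 f : L2 n) ξ‖ ^ 2) := by
  have h1 : ∫⁻ x, ENNReal.ofReal (‖f (x + h) - f x‖ ^ 2) =
      ∫⁻ x, ENNReal.ofReal (‖(translateL2 h f - f : L2 n) x‖ ^ 2) := by
    refine lintegral_congr_ae ?_
    filter_upwards [translateL2_ae h f, Lp.coeFn_sub (translateL2 h f) f] with x h1 h2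
    rw [h2, Pi.sub_apply, h1]
  rw [h1, lintegral_norm_sq, ← Lp.norm_fourier_eq, ← lintegral_norm_sq, fourier_sub_L2,
    fourier_translateL2]
  refine lintegral_congr_ae ?_
  filter_upwards [mulUnit_ae (character h) (continuous_character h) (norm_character h) (𝓕 f),
    Lp.coeFn_sub (mulUnit (character h) (continuous_character h) (norm_character h) (𝓕 f)) (𝓕 f)]
    with x h1 h2
  rw [h2, Pi.sub_apply, h1, ← mul_pow, ← norm_mul, sub_mul, one_mul]

/-- Substitute y = x + h, apply Plancherel in x for each fixed h, and exchange integrals by Tonelli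
before and after. -/
theorem gagliardo_eq_lintegral_symbol (f : L2 n) :
    gagliardo δ f =
      ∫⁻ ξ, gagliardoSymbol δ ξ * ENNReal.ofReal (‖(𝓕 f : L2 n) ξ‖ ^ 2) := by
  have hf := L2.measurable f
  have hF := L2.measurable (𝓕 f)
  have hk := measurable_gagliardoKernel (n := n) (δ := δ)
  have hch := measurable_character_prod (n := n)
  calc gagliardo δ f
      = ∫⁻ x, ∫⁻ h, ENNReal.ofReal (‖f (x + h) - f x‖ ^ 2 * gagliardoKernel n δ h) := by
        refine lintegral_congr fun x => ?_
        rw [← lintegral_add_left_eq_self _ x]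
        refine lintegral_congr fun h => ?_
        rw [add_sub_cancel_left]
    _ = ∫⁻ h, ∫⁻ x, ENNReal.ofReal (‖f (x + h) - f x‖ ^ 2 * gagliardoKernel n δ h) := by
        refine lintegral_lintegral_swap (Measurable.aemeasurable ?_)
        refine ENNReal.measurable_ofReal.comp (Measurable.mul ?_ (hk.comp measurable_snd))
        exact (((hf.comp (measurable_fst.add measurable_snd)).sub
          (hf.comp measurable_fst)).norm.pow_const 2)
    _ = ∫⁻ h, ∫⁻ ξ, ENNReal.ofReal (‖character h ξ - 1‖ ^ 2 * gagliardoKernel n δ h) *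
          ENNReal.ofReal (‖(𝓕 f : L2 n) ξ‖ ^ 2) := by
        refine lintegral_congr fun h => ?_
        have e1 : ∀ x, ENNReal.ofReal (‖f (x + h) - f x‖ ^ 2 * gagliardoKernel n δ h) =
            ENNReal.ofReal (gagliardoKernel n δ h) * ENNReal.ofReal (‖f (x + h) - f x‖ ^ 2) := by
          intro x
          rw [mul_comm, ENNReal.ofReal_mul (gagliardoKernel_nonneg h)]
        have e2 : ∀ ξ, ENNReal.ofReal (‖character h ξ - 1‖ ^ 2 * gagliardoKernel n δ h) *
            ENNReal.ofReal (‖(𝓕 f : L2 n) ξ‖ ^ 2) = ENNReal.ofReal (gagliardoKernel n δ h) *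
              ENNReal.ofReal (‖character h ξ - 1‖ ^ 2 * ‖(𝓕 f : L2 n) ξ‖ ^ 2) := by
          intro ξ
          rw [← ENNReal.ofReal_mul (mul_nonneg (by positivity) (gagliardoKernel_nonneg h)),
            ← ENNReal.ofReal_mul (gagliardoKernel_nonneg h)]
          congr 1; ring
        simp_rw [e1, e2]
        rw [lintegral_const_mul' _ _ ENNReal.ofReal_ne_top,
          lintegral_const_mul' _ _ ENNReal.ofReal_ne_top, lintegral_norm_translate_sub_sq]
    _ = ∫⁻ ξ, ∫⁻ h, ENNReal.ofReal (‖character h ξ - 1‖ ^ 2 * gagliardoKernel n δ h) *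
          ENNReal.ofReal (‖(𝓕 f : L2 n) ξ‖ ^ 2) := by
        refine lintegral_lintegral_swap (Measurable.aemeasurable ?_)
        refine Measurable.mul (ENNReal.measurable_ofReal.comp (Measurable.mul ?_
          (hk.comp measurable_fst))) (ENNReal.measurable_ofReal.comp
            ((hF.comp measurable_snd).norm.pow_const 2))
        exact (hch.sub_const 1).norm.pow_const 2
    _ = _ := by
        refine lintegral_congr fun ξ => ?_
        rw [lintegral_mul_const' _ _ ENNReal.ofReal_ne_top]
        rfl

theorem gagliardoSymbol_smul {s : ℝ} (hs : 0 < s) (ξ : Rn n) :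
    gagliardoSymbol δ (s • ξ) = ENNReal.ofReal (s ^ (2 * δ)) * gagliardoSymbol δ ξ := by
  have h1 : gagliardoSymbol δ (s • ξ) = ENNReal.ofReal (s ^ ((n : ℝ) + 2 * δ)) *
      ∫⁻ h, ENNReal.ofReal (‖character (s • h) ξ - 1‖ ^ 2 * gagliardoKernel n δ (s • h)) := by
    rw [gagliardoSymbol, ← lintegral_const_mul' _ _ ENNReal.ofReal_ne_top]
    refine lintegral_congr fun h => ?_
    rw [← ENNReal.ofReal_mul (by positivity)]
    congr 1
    have e1 : character h (s • ξ) = character (s • h) ξ := by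
      simp only [character, real_inner_smul_left, real_inner_smul_right]
    have e2 : s ^ ((n : ℝ) + 2 * δ) * gagliardoKernel n δ (s • h) = gagliardoKernel n δ h := by
      rw [gagliardoKernel, gagliardoKernel, norm_smul, Real.norm_of_nonneg hs.le,
        Real.mul_rpow hs.le (norm_nonneg _), ← mul_assoc, ← Real.rpow_add hs]
      simp
    rw [e1, ← e2]; ring
  rw [h1, lintegral_comp_smul' (fun h => ENNReal.ofReal (‖character h ξ - 1‖ ^ 2 *
    gagliardoKernel n δ h)) hs.ne', ← mul_assoc, ← ENNReal.ofReal_mul (by positivity), abs_of_pos hs,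
    ← Real.rpow_add hs, gagliardoSymbol]
  congr 3; ring

theorem gagliardoSymbol_isometry (A : Rn n ≃ₗᵢ[ℝ] Rn n) (ξ : Rn n) :
    gagliardoSymbol δ (A ξ) = gagliardoSymbol δ ξ := by
  rw [gagliardoSymbol, ← A.measurePreserving.lintegral_comp_emb
    A.toHomeomorph.toMeasurableEquiv.measurableEmbedding]
  refine lintegral_congr fun h => ?_
  simp only [character, gagliardoKernel, LinearIsometryEquiv.inner_map_map,
    LinearIsometryEquiv.norm_map]

/-- The symbol is homogeneous of degree 2δ and invariant under isometries, hence determined by its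
value at one unit vector: a reflection carries ξ/|ξ| to e. -/
theorem gagliardoSymbol_eq {e : Rn n} (he : ‖e‖ = 1) (hδ : 0 < δ) (ξ : Rn n) :
    gagliardoSymbol δ ξ = ENNReal.ofReal (‖ξ‖ ^ (2 * δ)) * gagliardoSymbol δ e := by
  by_cases hξ : ξ = 0
  · subst hξ
    have : (2 * δ) ≠ 0 := by positivity
    simp [gagliardoSymbol, character, Real.zero_rpow this]
  · have hpos : 0 < ‖ξ‖ := norm_pos_iff.mpr hξ
    have h1 : ‖‖ξ‖⁻¹ • ξ‖ = ‖e‖ := by rw [norm_smul, he]; simp [hpos.ne']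
    have h2 := gagliardoSymbol_isometry (δ := δ)
      (Submodule.reflection (Submodule.span ℝ {‖ξ‖⁻¹ • ξ - e})ᗮ) (‖ξ‖⁻¹ • ξ)
    rw [Submodule.reflection_sub h1] at h2
    rw [h2, ← gagliardoSymbol_smul hpos, smul_smul, mul_inv_cancel₀ hpos.ne', one_smul]

theorem norm_character_sub_one_le (h ξ : Rn n) :
    ‖character h ξ - 1‖ ≤ 2 * Real.pi * ‖h‖ * ‖ξ‖ := by
  have h1 := Real.norm_exp_I_mul_ofReal_sub_one_le (x := 2 * Real.pi * inner ℝ h ξ)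
  rw [mul_comm Complex.I] at h1
  refine h1.trans ?_
  rw [norm_mul, Real.norm_of_nonneg (by positivity : (0 : ℝ) ≤ 2 * Real.pi)]
  rw [mul_assoc (2 * Real.pi)]
  exact mul_le_mul_of_nonneg_left (abs_real_inner_le_norm h ξ) (by positivity)

/-- Near 0 the integrand is O(|h|^{2-n-2δ}), integrable because δ < 1; away from 0 it is
O(|h|^{-n-2δ}), integrable because δ > 0. -/
theorem gagliardoSymbol_lt_top (hn : 0 < n) (hδ0 : 0 < δ) (hδ1 : δ < 1) {e : Rn n}
    (he : ‖e‖ = 1) : gagliardoSymbol δ e < ⊤ := by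
  set F : Rn n → ℝ := fun h => ‖character h e - 1‖ ^ 2 * gagliardoKernel n δ h with hF
  have hF0 : ∀ h, 0 ≤ F h := fun h => mul_nonneg (by positivity) (gagliardoKernel_nonneg h)
  have hFm : Measurable F := by
    have hch := (measurable_character_prod (n := n)).comp
      (measurable_id.prodMk (measurable_const (a := e)))
    exact ((hch.sub_const 1).norm.pow_const 2).mul measurable_gagliardoKernel
  suffices h : Integrable F by
    exact h.lintegral_lt_top
  rw [← integrableOn_univ, ← Set.union_compl_self (Metric.ball (0 : Rn n) 1)]
  refine IntegrableOn.union ?_ ?_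
  · refine integrableOn_ball_of_norm_le_rpow (C := (2 * Real.pi) ^ 2) (α := n + 2 * δ - 2)
      (by simp; omega) (by simp; linarith) (Eventually.of_forall fun h => ?_)
      hFm.aestronglyMeasurable
    rw [Real.norm_of_nonneg (hF0 h)]
    have h1 := norm_character_sub_one_le h e
    rw [he, mul_one] at h1
    have h2 : ‖character h e - 1‖ ^ 2 ≤ (2 * Real.pi * ‖h‖) ^ 2 := by gcongr
    refine (mul_le_mul_of_nonneg_right h2 (gagliardoKernel_nonneg h)).trans ?_
    by_cases hh : h = 0
    · subst hh
      have : 0 ≤ (0 : ℝ) ^ (-((n : ℝ) + 2 * δ - 2)) := by positivity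
      simp; positivity
    · have hp : 0 < ‖h‖ := norm_pos_iff.mpr hh
      rw [gagliardoKernel, mul_pow, mul_assoc, ← Real.rpow_natCast ‖h‖ 2, ← Real.rpow_add hp]
      refine le_of_eq ?_
      congr 2; push_cast; ring
  · have hi : Integrable (fun h : Rn n => (4 * 2 ^ ((n : ℝ) + 2 * δ)) *
        (1 + ‖h‖) ^ (-((n : ℝ) + 2 * δ))) :=
      (integrable_one_add_norm (by simp; linarith)).const_mul _
    refine Integrable.mono' hi.integrableOn hFm.aestronglyMeasurable ?_
    refine (ae_restrict_iff' Metric.isOpen_ball.measurableSet.compl).mpr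
      (Eventually.of_forall fun h hh => ?_)
    have h1 : 1 ≤ ‖h‖ := by simpa using hh
    have hp : 0 < ‖h‖ := by linarith
    rw [Real.norm_of_nonneg (hF0 h)]
    have h2 : ‖character h e - 1‖ ≤ 2 := by
      refine (norm_sub_le _ _).trans ?_
      rw [norm_character]; norm_num
    have h3 : ‖character h e - 1‖ ^ 2 ≤ 4 := by nlinarith [norm_nonneg (character h e - 1)]
    have h4 : gagliardoKernel n δ h ≤ 2 ^ ((n : ℝ) + 2 * δ) * (1 + ‖h‖) ^ (-((n : ℝ) + 2 * δ)) := by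
      rw [gagliardoKernel, Real.rpow_neg hp.le, Real.rpow_neg (by positivity), ← div_eq_mul_inv,
        ← Real.div_rpow (by positivity) (by positivity), ← Real.inv_rpow hp.le]
      refine Real.rpow_le_rpow (by positivity) ?_ (by positivity)
      rw [inv_eq_one_div, div_le_div_iff₀ hp (by positivity)]
      linarith
    rw [mul_assoc]
    exact mul_le_mul h3 h4 (gagliardoKernel_nonneg h) (by norm_num)

/-- If it vanished, the character would be 1 almost everywhere and, by continuity, everywhere; at h
= e/2 it equals e^{πi} = -1. -/
theorem gagliardoSymbol_ne_zero {e : Rn n} (he : ‖e‖ = 1) : gagliardoSymbol δ e ≠ 0 := by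
  have he0 : e ≠ 0 := by rintro rfl; simp at he
  have : Nontrivial (Rn n) := ⟨e, 0, he0⟩
  have hch := (measurable_character_prod (n := n)).comp
      (measurable_id.prodMk (measurable_const (a := e)))
  have hm : Measurable fun h : Rn n =>
      ENNReal.ofReal (‖character h e - 1‖ ^ 2 * gagliardoKernel n δ h) :=
    ENNReal.measurable_ofReal.comp
      (((hch.sub_const 1).norm.pow_const 2).mul measurable_gagliardoKernel)
  rw [gagliardoSymbol, Ne, lintegral_eq_zero_iff hm]
  intro h
  have h0 : ∀ᵐ x : Rn n, x ≠ 0 := by simp [ae_iff]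
  have h1 : (fun h => character h e) =ᵐ[volume] fun _ => (1 : ℂ) := by
    filter_upwards [h, h0] with x hx hx0
    have h2 := ENNReal.ofReal_eq_zero.mp hx
    by_contra h3
    have h4 : 0 < ‖character x e - 1‖ ^ 2 := pow_pos (norm_pos_iff.mpr (sub_ne_zero.mpr h3)) 2
    exact absurd h2 (not_le.mpr (mul_pos h4 (gagliardoKernel_pos hx0)))
  have hc : Continuous fun h : Rn n => character h e := by unfold character; fun_prop
  have h5 := congrFun ((hc.ae_eq_iff_eq volume continuous_const).mp h1) ((1 / 2 : ℝ) • e)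
  simp only [character, real_inner_smul_left, real_inner_self_eq_norm_sq, he] at h5
  rw [show (2 * Real.pi * (1 / 2 * 1 ^ 2) : ℝ) = Real.pi by ring, Complex.exp_pi_mul_I] at h5
  norm_num at h5

/-- The Gagliardo form is a multiple of the Fourier moment. -/
theorem exists_gagliardo_eq (hn : 0 < n) (hδ0 : 0 < δ) (hδ1 : δ < 1) :
    ∃ c : ℝ≥0∞, c ≠ 0 ∧ c ≠ ⊤ ∧ ∀ f : L2 n, gagliardo δ f = c * moment δ (𝓕 f : L2 n) := by
  let e : Rn n := EuclideanSpace.single ⟨0, hn⟩ 1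
  have he : ‖e‖ = 1 := by simp [e]
  have htop := (gagliardoSymbol_lt_top hn hδ0 hδ1 he).ne
  refine ⟨gagliardoSymbol δ e, gagliardoSymbol_ne_zero he, htop, fun f => ?_⟩
  rw [gagliardo_eq_lintegral_symbol, moment, ← lintegral_const_mul' _ _ htop]
  refine lintegral_congr fun ξ => ?_
  rw [gagliardoSymbol_eq he hδ0, ENNReal.ofReal_mul (by positivity)]
  ring

/-! ### Compactness of energy sublevel sets -/

/-- Sequential Banach–Alaoglu, transported by the Riesz isomorphism. Only the existence of the
limits of the pairings is recorded; the weak limit itself is not needed. -/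
theorem exists_subseq_weakly_convergent (u : ℕ → L2 n) (hu : ∀ j, ‖u j‖ ≤ 1) :
    ∃ ns : ℕ → ℕ, StrictMono ns ∧ ∀ v : L2 n, ∃ L : ℂ,
      Tendsto (fun j => inner ℂ v (u (ns j))) atTop (𝓝 L) := by
  have : Fact ((2 : ℝ≥0∞) ≠ ⊤) := ⟨by norm_num⟩
  let w : ℕ → WeakDual ℂ (L2 n) := fun j =>
    StrongDual.toWeakDual (InnerProductSpace.toDual ℂ (L2 n) (u j))
  obtain ⟨l, -, ns, hns, hl⟩ := WeakDual.isSeqCompact_closedBall ℂ (L2 n) 0 1 (x := w) (fun j => by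
    simp [w, hu])
  refine ⟨ns, hns, fun v => ⟨starRingEnd ℂ (l v), ?_⟩⟩
  have h1 : Tendsto (fun j => w (ns j) v) atTop (𝓝 (l v)) :=
    ((WeakDual.eval_continuous v).tendsto l).comp hl
  have h2 := (Complex.continuous_conj.tendsto _).comp h1
  refine h2.congr fun j => ?_
  exact inner_conj_symm (𝕜 := ℂ) v (u (ns j))

/-- Restriction of an `L²` function to the ball of radius `R`. -/
def cutoff (R : ℝ) (f : L2 n) : L2 n :=
  ((Lp.memLp f).indicator (Metric.isOpen_ball (x := (0 : Rn n)) (ε := R)).measurableSet).toLp _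

theorem cutoff_ae (R : ℝ) (f : L2 n) :
    cutoff R f =ᵐ[volume] (Metric.ball (0 : Rn n) R).indicator f :=
  MemLp.coeFn_toLp _

theorem norm_cutoff_le (R : ℝ) (f : L2 n) : ‖cutoff R f‖ ≤ ‖f‖ := by
  refine Lp.norm_le_norm_of_ae_le ?_
  filter_upwards [cutoff_ae R f] with x hx
  rw [hx]
  exact norm_indicator_le_norm_self _ _

theorem cutoff_sub (R : ℝ) (f g : L2 n) : cutoff R (f - g) = cutoff R f - cutoff R g := by
  apply Lp.ext
  filter_upwards [cutoff_ae R (f - g), cutoff_ae R f, cutoff_ae R g, Lp.coeFn_sub f g,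
    Lp.coeFn_sub (cutoff R f) (cutoff R g)] with x h1 h2 h3 h4 h5
  rw [h1, h5, Pi.sub_apply, h2, h3]
  rw [Pi.sub_apply] at h4
  by_cases hx : x ∈ Metric.ball (0 : Rn n) R
  · rw [Set.indicator_of_mem hx, Set.indicator_of_mem hx, Set.indicator_of_mem hx, h4]
  · simp [hx]

/-- Chebyshev: outside the ball, 1 ≤ R^{-2δ}|x|^{2δ}. -/
theorem ofReal_norm_sub_cutoff_sq_le {R : ℝ} (hR : 0 < R) (hδ : 0 ≤ δ) (f : L2 n) :
    ENNReal.ofReal (‖f - cutoff R f‖ ^ 2) ≤ ENNReal.ofReal (R ^ (-(2 * δ))) * moment δ f := by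
  rw [← lintegral_norm_sq, moment, ← lintegral_const_mul' _ _ ENNReal.ofReal_ne_top]
  refine lintegral_mono_ae ?_
  filter_upwards [cutoff_ae R f, Lp.coeFn_sub f (cutoff R f)] with x h1 h2
  rw [h2, Pi.sub_apply, h1, ← ENNReal.ofReal_mul (by positivity)]
  refine ENNReal.ofReal_le_ofReal ?_
  by_cases hx : x ∈ Metric.ball (0 : Rn n) R
  · simp only [hx, Set.indicator_of_mem, sub_self, norm_zero]
    have : 0 ≤ R ^ (-(2 * δ)) * (‖x‖ ^ (2 * δ) * ‖f x‖ ^ 2) := by positivity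
    simpa using this
  · simp only [hx, not_false_eq_true, Set.indicator_of_notMem, sub_zero]
    have h3 : R ≤ ‖x‖ := by simpa using hx
    have h4 : R ^ (2 * δ) ≤ ‖x‖ ^ (2 * δ) := Real.rpow_le_rpow hR.le h3 (by positivity)
    have h5 : 1 ≤ R ^ (-(2 * δ)) * ‖x‖ ^ (2 * δ) := by
      rw [Real.rpow_neg hR.le, inv_mul_eq_div, le_div_iff₀ (by positivity), one_mul]
      exact h4
    rw [← mul_assoc]
    exact le_mul_of_one_le_left (by positivity) h5

/-! ### Localization in space and frequency is compact. -/

/-- The localization of `f` to the balls of radius `R` in frequency and then in space. -/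
def localize (R : ℝ) (f : L2 n) : L2 n := cutoff R (𝓕⁻ (cutoff R (𝓕 f)))

theorem norm_sub_localize_le (R : ℝ) (f : L2 n) :
    ‖f - localize R f‖ ≤ ‖f - cutoff R f‖ + ‖𝓕 f - cutoff R (𝓕 f)‖ := by
  have h1 : f - localize R f = (f - cutoff R f) + cutoff R (f - 𝓕⁻ (cutoff R (𝓕 f))) := by
    rw [cutoff_sub, localize]; abel
  have h2 : (𝓕 (f - 𝓕⁻ (cutoff R (𝓕 f))) : L2 n) = 𝓕 f - cutoff R (𝓕 f) := by
    rw [fourier_sub_L2, FourierTransform.fourier_fourierInv_eq]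
  rw [h1, ← h2, Lp.norm_fourier_eq]
  exact (norm_add_le _ _).trans (add_le_add_right (norm_cutoff_le _ _) _)

/-- The conjugate of a character, restricted to a ball. -/
def ballCharacter (R : ℝ) (x : Rn n) : L2 n :=
  mulUnit (fun ξ => starRingEnd ℂ (character x ξ))
    (Complex.continuous_conj.comp (continuous_character x))
    (fun ξ => by rw [RCLike.norm_conj, norm_character])
    (indicatorConstLp 2 (Metric.isOpen_ball (x := (0 : Rn n)) (ε := R)).measurableSet
      measure_ball_lt_top.ne (1 : ℂ))

theorem norm_ballCharacter (R : ℝ) (x : Rn n) : ‖ballCharacter R x‖ = ‖ballCharacter R (0 : Rn n)‖ := by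
  simp only [ballCharacter, LinearIsometry.norm_map]

/-- After a frequency cutoff, point values are inner products with fixed `L²` vectors, so weak
convergence becomes pointwise convergence. -/
theorem fourierInv_cutoff_ae (R : ℝ) (F : L2 n) :
    (𝓕⁻ (cutoff R F) : L2 n) =ᵐ[volume] fun x => inner ℂ (ballCharacter R x) F := by
  have hball : MeasurableSet (Metric.ball (0 : Rn n) R) := Metric.isOpen_ball.measurableSet
  have hint : Integrable ((Metric.ball (0 : Rn n) R).indicator F) := by
    rw [integrable_indicator_iff hball]
    have : IsFiniteMeasure (volume.restrict (Metric.ball (0 : Rn n) R)) :=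
      ⟨by simpa using measure_ball_lt_top⟩
    exact ((Lp.memLp F).restrict _).integrable one_le_two
  filter_upwards [fourierInv_ae_eq_of_integrable _ (hint.congr (cutoff_ae R F).symm)] with x hx
  rw [hx, Real.fourierInv_congr_ae (cutoff_ae R F), Real.fourierInv_eq', MeasureTheory.L2.inner_def]
  refine integral_congr_ae ?_
  filter_upwards [mulUnit_ae (fun ξ => starRingEnd ℂ (character x ξ))
    (Complex.continuous_conj.comp (continuous_character x))
    (fun ξ => by rw [RCLike.norm_conj, norm_character])
    (indicatorConstLp 2 hball measure_ball_lt_top.ne (1 : ℂ)),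
    indicatorConstLp_coeFn (p := 2) (hs := hball) (hμs := measure_ball_lt_top.ne) (c := (1 : ℂ))]
    with ξ h1 h2
  rw [ballCharacter, h1, h2]
  by_cases hξ : ξ ∈ Metric.ball (0 : Rn n) R
  · simp only [Set.indicator_of_mem hξ, RCLike.inner_apply, mul_one, RingHomCompTriple.comp_apply,
      RingHom.id_apply, smul_eq_mul, character, real_inner_comm]
    ring
  · simp [hξ]

/-- The localized functions converge pointwise and are bounded by a constant on a ball of finite
volume, so dominated convergence applies to the squared differences. -/
theorem cauchySeq_localize {u : ℕ → L2 n} (hu : ∀ j, ‖u j‖ ≤ 1)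
    (hw : ∀ v : L2 n, ∃ L : ℂ, Tendsto (fun j => inner ℂ v (u j)) atTop (𝓝 L)) (R : ℝ) :
    CauchySeq fun j => localize R (u j) := by
  have hball : MeasurableSet (Metric.ball (0 : Rn n) R) := Metric.isOpen_ball.measurableSet
  set C : ℝ := ‖ballCharacter R (0 : Rn n)‖ with hC
  have hpt : ∀ x : Rn n, CauchySeq fun j => inner ℂ (ballCharacter R x) (𝓕 (u j) : L2 n) := by
    intro x
    obtain ⟨L, hL⟩ := hw (𝓕⁻ (ballCharacter R x))
    refine (hL.congr fun j => ?_).cauchySeq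
    rw [← Lp.inner_fourier_eq, FourierTransform.fourier_fourierInv_eq]
  have hbd : ∀ j (x : Rn n), ‖inner ℂ (ballCharacter R x) (𝓕 (u j) : L2 n)‖ ≤ C := by
    intro j x
    refine (norm_inner_le_norm _ _).trans ?_
    rw [norm_ballCharacter, Lp.norm_fourier_eq]
    exact mul_le_of_le_one_right (norm_nonneg _) (hu j)
  have hval : ∀ j, localize R (u j) =ᵐ[volume] (Metric.ball (0 : Rn n) R).indicator fun x =>
      inner ℂ (ballCharacter R x) (𝓕 (u j) : L2 n) := by
    intro j
    filter_upwards [cutoff_ae R (𝓕⁻ (cutoff R (𝓕 (u j)))), fourierInv_cutoff_ae R (𝓕 (u j))]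
      with x h1 h2
    rw [localize, h1]
    by_cases hx : x ∈ Metric.ball (0 : Rn n) R <;> simp [hx, h2]
  have hval' : ∀ᵐ x : Rn n, ∀ j, localize R (u j) x = (Metric.ball (0 : Rn n) R).indicator (fun x =>
      inner ℂ (ballCharacter R x) (𝓕 (u j) : L2 n)) x := ae_all_iff.mpr hval
  have hsub : ∀ᵐ x : Rn n, ∀ p : ℕ × ℕ, (localize R (u p.1) - localize R (u p.2) : L2 n) x =
      localize R (u p.1) x - localize R (u p.2) x :=
    ae_all_iff.mpr fun p => Lp.coeFn_sub _ _
  rw [cauchySeq_iff_tendsto_dist_atTop_0]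
  have hlim : Tendsto (fun p : ℕ × ℕ => ∫⁻ x, ENNReal.ofReal
      (‖(localize R (u p.1) - localize R (u p.2) : L2 n) x‖ ^ 2)) atTop (𝓝 (∫⁻ _ : Rn n, 0)) := by
    refine tendsto_lintegral_filter_of_dominated_convergence
      ((Metric.ball (0 : Rn n) R).indicator fun _ => ENNReal.ofReal ((2 * C) ^ 2))
      (Eventually.of_forall fun p => ?_) (Eventually.of_forall fun p => ?_) ?_ ?_
    · exact ENNReal.measurable_ofReal.comp ((L2.measurable _).norm.pow_const 2)
    · filter_upwards [hval', hsub] with x h1 h2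
      rw [h2, h1, h1]
      by_cases hx : x ∈ Metric.ball (0 : Rn n) R
      · simp only [hx, Set.indicator_of_mem]
        refine ENNReal.ofReal_le_ofReal ?_
        have h3 := (norm_sub_le (inner ℂ (ballCharacter R x) (𝓕 (u p.1) : L2 n))
          (inner ℂ (ballCharacter R x) (𝓕 (u p.2) : L2 n))).trans
            (add_le_add (hbd p.1 x) (hbd p.2 x))
        rw [← two_mul] at h3
        gcongr
      · simp [hx]
    · rw [lintegral_indicator hball, lintegral_const]
      simp only [Measure.restrict_apply_univ]
      exact ENNReal.mul_ne_top ENNReal.ofReal_ne_top measure_ball_lt_top.ne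
    · filter_upwards [hval', hsub] with x h1 h2
      simp only [h2, h1]
      by_cases hx : x ∈ Metric.ball (0 : Rn n) R
      · simp only [hx, Set.indicator_of_mem, ← dist_eq_norm]
        have h3 := (cauchySeq_iff_tendsto_dist_atTop_0.mp (hpt x)).pow 2
        simpa using ENNReal.tendsto_ofReal h3
      · simp [hx]
  rw [lintegral_zero] at hlim
  simp only [lintegral_norm_sq] at hlim
  have h4 := (ENNReal.tendsto_toReal ENNReal.zero_ne_top).comp hlim
  have h5 := (h4.congr fun p => ENNReal.toReal_ofReal (by positivity)).sqrt
  simpa [dist_eq_norm, Real.sqrt_sq] using h5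

/-- A bounded sequence of bounded energy has an `L²` convergent subsequence. -/
theorem exists_subseq_tendsto (hδ : 0 < δ) {u : ℕ → L2 n} (hu : ∀ j, ‖u j‖ ≤ 1) {M : ℝ}
    (hM0 : 0 ≤ M) (hM : ∀ j, energy δ (u j) ≤ ENNReal.ofReal M) :
    ∃ ns : ℕ → ℕ, StrictMono ns ∧ ∃ f : L2 n, Tendsto (u ∘ ns) atTop (𝓝 f) := by
  obtain ⟨ns, hns, hw⟩ := exists_subseq_weakly_convergent u hu
  refine ⟨ns, hns, cauchySeq_tendsto_of_complete ?_⟩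
  have htail : ∀ (g : L2 n) (R : ℝ), 0 < R → moment δ g ≤ ENNReal.ofReal M →
      ‖g - cutoff R g‖ ≤ √(R ^ (-(2 * δ)) * M) := by
    intro g R hR hg
    refine Real.le_sqrt_of_sq_le ?_
    have h1 := (ofReal_norm_sub_cutoff_sq_le hR hδ.le g).trans (mul_le_mul_right hg _)
    rw [← ENNReal.ofReal_mul (by positivity)] at h1
    exact (ENNReal.ofReal_le_ofReal_iff (by positivity)).mp h1
  have hlim : Tendsto (fun R : ℝ => √(R ^ (-(2 * δ)) * M)) atTop (𝓝 0) := by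
    simpa using ((tendsto_rpow_neg_atTop (by positivity : 0 < 2 * δ)).mul_const M).sqrt
  rw [Metric.cauchySeq_iff]
  intro ε hε
  -- One tail in space and one in frequency, each below ε/6, leave ε/3 for each of the three terms
  -- in the final triangle inequality.
  obtain ⟨R, hRε, hR⟩ := ((hlim.eventually_lt_const (by positivity : 0 < ε / 6)).and
    (eventually_gt_atTop 0)).exists
  have happrox : ∀ j, dist (u (ns j)) (localize R (u (ns j))) < ε / 3 := by
    intro j
    rw [dist_eq_norm]
    have h1 := norm_sub_localize_le R (u (ns j))
    have h2 := htail (u (ns j)) R hR (le_self_add.trans (hM (ns j)))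
    have h3 := htail (𝓕 (u (ns j))) R hR (le_add_self.trans (hM (ns j)))
    linarith
  obtain ⟨N, hN⟩ := Metric.cauchySeq_iff.mp
    (cauchySeq_localize (u := u ∘ ns) (fun j => hu _) hw R) (ε / 3) (by positivity)
  refine ⟨N, fun i hi j hj => ?_⟩
  have h1 := happrox i
  have h2 := happrox j
  have h3 := hN i hi j hj
  rw [dist_comm] at h2
  have h4 := dist_triangle4 (u (ns i)) (localize R (u (ns i))) (localize R (u (ns j))) (u (ns j))
  simp only [Function.comp_apply] at h3 ⊢
  linarith

/-! ### The ground state energy -/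

/-- A compactly supported Schwartz function equal to `1` on the ball of radius `R`. -/
theorem exists_schwartz_bump (n : ℕ) {R : ℝ} (hR : 0 < R) :
    ∃ (η : 𝓢(Rn n, ℂ)) (b : Rn n → ℝ), (∀ x, η x = b x) ∧ (∀ x, 0 ≤ b x) ∧ (∀ x, b x ≤ 1) ∧
      (∀ x, ‖x‖ ≤ R → b x = 1) ∧ (∀ x, R + 1 ≤ ‖x‖ → b x = 0) := by
  let b : ContDiffBump (0 : Rn n) := ⟨R, R + 1, hR, by linarith⟩
  have h₁ : HasCompactSupport (Complex.ofRealCLM ∘ b) := b.hasCompactSupport.comp_left rfl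
  have h₂ : ContDiff ℝ (⊤ : ℕ∞) (Complex.ofRealCLM ∘ b) :=
    Complex.ofRealCLM.contDiff.comp b.contDiff
  refine ⟨h₁.toSchwartzMap h₂, b, fun x => rfl, fun x => b.nonneg, fun x => b.le_one,
    fun x hx => b.one_of_mem_closedBall (by simpa using hx), fun x hx => ?_⟩
  exact b.zero_of_le_dist (by simpa using hx)

/-- The least energy of a unit vector. -/
def groundEnergy (n : ℕ) (δ : ℝ) : ℝ≥0∞ := sInf (energy δ '' {f : L2 n | ‖f‖ = 1})

theorem groundEnergy_lt_top (n : ℕ) (hδ0 : 0 ≤ δ) (hδ1 : δ ≤ 1) : groundEnergy n δ < ⊤ := by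
  obtain ⟨η, b, hη, -, -, hb, -⟩ := exists_schwartz_bump n one_pos
  have hne : (η.toLp 2 volume : L2 n) ≠ 0 := by
    intro h
    have h1 : η = 0 := SchwartzMap.injective_toLp (E := Rn n) (F := ℂ) 2 volume (by
      simp only [h]
      exact (map_zero (SchwartzMap.toLpCLM ℂ (E := Rn n) ℂ 2 volume)).symm)
    have h2 := hη 0
    rw [h1, hb 0 (by simp)] at h2
    simp at h2
  set g : L2 n := η.toLp 2 volume with hg
  have hpos : 0 < ‖g‖ := norm_pos_iff.mpr hne
  have h1 : energy δ ((((‖g‖⁻¹ : ℝ)) : ℂ) • g) < ⊤ := by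
    rw [energy_smul]
    exact ENNReal.mul_lt_top ENNReal.ofReal_lt_top (energy_schwartz_lt_top η hδ0 hδ1)
  refine lt_of_le_of_lt (sInf_le ⟨_, ?_, rfl⟩) h1
  rw [Set.mem_ofPred_eq, norm_smul, Complex.norm_real, norm_inv, norm_norm, inv_mul_cancel₀ hpos.ne']

theorem groundEnergy_mul_le (f : L2 n) :
    groundEnergy n δ * ENNReal.ofReal (‖f‖ ^ 2) ≤ energy δ f := by
  by_cases hf : f = 0
  · simp [hf]
  have hpos : 0 < ‖f‖ := norm_pos_iff.mpr hf
  have h1 : groundEnergy n δ ≤ energy δ ((((‖f‖⁻¹ : ℝ)) : ℂ) • f) := by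
    refine sInf_le ⟨_, ?_, rfl⟩
    rw [Set.mem_ofPred_eq, norm_smul, Complex.norm_real, norm_inv, norm_norm,
      inv_mul_cancel₀ hpos.ne']
  calc groundEnergy n δ * ENNReal.ofReal (‖f‖ ^ 2)
      ≤ energy δ ((((‖f‖⁻¹ : ℝ)) : ℂ) • f) * ENNReal.ofReal (‖f‖ ^ 2) := mul_le_mul_left h1 _
    _ = energy δ f := by
      rw [energy_smul, mul_right_comm, ← ENNReal.ofReal_mul (by positivity), Complex.norm_real,
        norm_inv, norm_norm, ← mul_pow, inv_mul_cancel₀ hpos.ne']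
      simp

/-- Direct method: a minimizing sequence of unit vectors has a norm convergent subsequence, so no
mass is lost, and the energy is lower semicontinuous. -/
theorem exists_ground_state (hδ0 : 0 < δ) (hδ1 : δ < 1) :
    ∃ f : L2 n, ‖f‖ = 1 ∧ energy δ f = groundEnergy n δ := by
  have htop := groundEnergy_lt_top n hδ0.le hδ1.le
  have hne : (energy δ '' {f : L2 n | ‖f‖ = 1}).Nonempty := by
    -- An empty unit sphere would give the infimum `⊤`, contradicting finiteness.
    by_contra h
    rw [Set.not_nonempty_iff_eq_empty] at h
    rw [groundEnergy, h, sInf_empty] at htop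
    exact lt_irrefl _ htop
  obtain ⟨e, he_anti, he_lim, he_mem⟩ := exists_seq_tendsto_sInf hne (OrderBot.bddBelow _)
  choose v hv using he_mem
  change Tendsto e atTop (𝓝 (groundEnergy n δ)) at he_lim
  -- Discarding the first N terms makes the energies uniformly bounded by E₀ + 1.
  obtain ⟨N, hN⟩ := (he_lim.eventually_lt_const
    (ENNReal.lt_add_right htop.ne one_ne_zero)).exists_forall_of_atTop
  have hM : ∀ j, energy δ (v (j + N)) ≤ ENNReal.ofReal (groundEnergy n δ + 1).toReal := by
    intro j
    rw [(hv _).2, ENNReal.ofReal_toReal (ENNReal.add_ne_top.mpr ⟨htop.ne, by simp⟩)]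
    exact (hN _ (Nat.le_add_left _ _)).le
  obtain ⟨ns, hns, f, hf⟩ := exists_subseq_tendsto hδ0 (u := fun j => v (j + N))
    (fun j => (hv _).1.le) ENNReal.toReal_nonneg hM
  have hf1 : ‖f‖ = 1 := by
    refine tendsto_nhds_unique hf.norm ?_
    refine tendsto_const_nhds.congr fun j => ?_
    exact ((hv _).1).symm
  refine ⟨f, hf1, le_antisymm ?_ (sInf_le ⟨f, hf1, rfl⟩)⟩
  refine energy_le_of_tendsto hf ?_
  have h1 : Tendsto (fun j => e (ns j + N)) atTop (𝓝 (groundEnergy n δ)) :=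
    he_lim.comp ((tendsto_add_atTop_nat N).comp hns.tendsto_atTop)
  exact h1.congr fun j => ((hv _).2).symm

/-! ### The ground space -/

/-- `f` attains the lower bound `groundEnergy · ‖f‖²` for the energy. -/
def IsGround (δ : ℝ) (f : L2 n) : Prop :=
  energy δ f = groundEnergy n δ * ENNReal.ofReal (‖f‖ ^ 2)

theorem IsGround.energy_lt_top {f : L2 n} (hf : IsGround δ f) (hδ0 : 0 ≤ δ) (hδ1 : δ ≤ 1) :
    energy δ f < ⊤ := by
  rw [hf]
  exact ENNReal.mul_lt_top (groundEnergy_lt_top n hδ0 hδ1) ENNReal.ofReal_lt_top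

/-- The excess E(f) - E₀‖f‖² is nonnegative and obeys the parallelogram law. If it vanishes at f and
g, its values at f + g and f - g sum to 0, so both vanish. -/
theorem IsGround.sub {f g : L2 n} (hf : IsGround δ f) (hg : IsGround δ g) (hδ0 : 0 ≤ δ)
    (hδ1 : δ ≤ 1) : IsGround δ (f - g) := by
  refine le_antisymm ?_ (groundEnergy_mul_le _)
  have h1 := energy_parallelogram (δ := δ) f g
  have h2 := groundEnergy_mul_le (δ := δ) (f + g)
  have hE := (groundEnergy_lt_top n hδ0 hδ1).ne
  have h3 : energy δ (f + g) + energy δ (f - g) =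
      groundEnergy n δ * ENNReal.ofReal (‖f + g‖ ^ 2) +
        groundEnergy n δ * ENNReal.ofReal (‖f - g‖ ^ 2) := by
    rw [h1, hf, hg, ← mul_add, ← mul_add, ← ENNReal.ofReal_add (by positivity) (by positivity),
      ← ENNReal.ofReal_add (by positivity) (by positivity), mul_left_comm]
    congr 1
    rw [two_mul (ENNReal.ofReal _), ← ENNReal.ofReal_add (by positivity) (by positivity)]
    congr 1
    have := parallelogram_law_with_norm ℂ f g
    linarith
  have h4 : groundEnergy n δ * ENNReal.ofReal (‖f + g‖ ^ 2) + energy δ (f - g) ≤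
      groundEnergy n δ * ENNReal.ofReal (‖f + g‖ ^ 2) +
        groundEnergy n δ * ENNReal.ofReal (‖f - g‖ ^ 2) := by
    rw [← h3]; gcongr
  exact (ENNReal.add_le_add_iff_left (ENNReal.mul_ne_top hE ENNReal.ofReal_ne_top)).mp h4

/-! ### Modulus, phase and uniqueness. -/

theorem gagliardo_congr_ae {f g : Rn n → ℂ} (h : f =ᵐ[volume] g) :
    gagliardo δ f = gagliardo δ g := by
  refine lintegral_congr_ae ?_
  filter_upwards [h] with x hx
  refine lintegral_congr_ae ?_
  filter_upwards [h] with y hy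
  simp only [hx, hy]

/-- The modulus of an `L²` function. -/
def absL2 (f : L2 n) : L2 n := (Lp.memLp f).norm.ofReal.toLp (fun x => ((‖f x‖ : ℝ) : ℂ))

theorem absL2_ae (f : L2 n) : absL2 f =ᵐ[volume] fun x => ((‖f x‖ : ℝ) : ℂ) :=
  MemLp.coeFn_toLp _

theorem norm_absL2 (f : L2 n) : ‖absL2 f‖ = ‖f‖ := by
  have h : ∀ᵐ x, ‖absL2 f x‖ = ‖f x‖ := (absL2_ae f).mono fun x hx => by simp [hx]
  exact le_antisymm (Lp.norm_le_norm_of_ae_le (h.mono fun x hx => hx.le))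
    (Lp.norm_le_norm_of_ae_le (h.mono fun x hx => hx.ge))

theorem moment_absL2 (f : L2 n) : moment δ (absL2 f) = moment δ f :=
  moment_congr_norm_ae ((absL2_ae f).mono fun x hx => by simp [hx])

theorem measurable_gagliardo_integrand {f : Rn n → ℂ} (hf : Measurable f) :
    Measurable fun p : Rn n × Rn n =>
      ENNReal.ofReal (‖f p.2 - f p.1‖ ^ 2 * gagliardoKernel n δ (p.2 - p.1)) := by
  refine ENNReal.measurable_ofReal.comp (Measurable.mul ?_ ?_)
  · exact ((hf.comp measurable_snd).sub (hf.comp measurable_fst)).norm.pow_const 2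
  · exact measurable_gagliardoKernel.comp (measurable_snd.sub measurable_fst)

theorem gagliardo_eq_lintegral_prod {f : Rn n → ℂ} (hf : Measurable f) :
    gagliardo δ f = ∫⁻ p : Rn n × Rn n,
      ENNReal.ofReal (‖f p.2 - f p.1‖ ^ 2 * gagliardoKernel n δ (p.2 - p.1))
        ∂((volume : Measure (Rn n)).prod volume) := by
  rw [lintegral_prod _ (measurable_gagliardo_integrand hf).aemeasurable]
  rfl

theorem norm_ofReal_norm_sub_le (a b : ℂ) : ‖((‖a‖ : ℝ) : ℂ) - ((‖b‖ : ℝ) : ℂ)‖ ≤ ‖a - b‖ := by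
  rw [← Complex.ofReal_sub, Complex.norm_real]
  exact abs_norm_sub_norm_le a b

theorem gagliardo_integrand_abs_le (f : Rn n → ℂ) (x y : Rn n) :
    ENNReal.ofReal (‖((‖f y‖ : ℝ) : ℂ) - ((‖f x‖ : ℝ) : ℂ)‖ ^ 2 * gagliardoKernel n δ (y - x)) ≤
      ENNReal.ofReal (‖f y - f x‖ ^ 2 * gagliardoKernel n δ (y - x)) := by
  refine ENNReal.ofReal_le_ofReal (mul_le_mul_of_nonneg_right ?_ (gagliardoKernel_nonneg _))
  have := norm_ofReal_norm_sub_le (f y) (f x)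
  gcongr

/-- The spatial moment sees only |f|, and the frequency moment is a multiple of the Gagliardo form,
whose integrand decreases by the reverse triangle inequality. -/
theorem energy_absL2_le (hn : 0 < n) (hδ0 : 0 < δ) (hδ1 : δ < 1) (f : L2 n) :
    energy δ (absL2 f) ≤ energy δ f := by
  obtain ⟨c, hc0, hct, hc⟩ := exists_gagliardo_eq hn hδ0 hδ1
  rw [energy, energy, moment_absL2]
  refine add_le_add_right ?_ _
  have h1 : gagliardo δ (absL2 f) ≤ gagliardo δ f := by
    rw [gagliardo_congr_ae (absL2_ae f)]
    exact lintegral_mono fun x => lintegral_mono fun y => gagliardo_integrand_abs_le f x y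
  rw [hc, hc] at h1
  exact (ENNReal.mul_le_mul_iff_right hc0 hct).mp h1

theorem IsGround.modulus (hn : 0 < n) (hδ0 : 0 < δ) (hδ1 : δ < 1) {f : L2 n} (hf : IsGround δ f) :
    IsGround δ (absL2 f) := by
  refine le_antisymm ?_ (groundEnergy_mul_le _)
  rw [norm_absL2, ← hf]
  exact energy_absL2_le hn hδ0 hδ1 f

/-- A ground state has constant phase. -/
theorem IsGround.exists_phase (hn : 0 < n) (hδ0 : 0 < δ) (hδ1 : δ < 1) {f : L2 n}
    (hf : IsGround δ f) : ∃ c : ℂ, ‖c‖ = 1 ∧ ∀ᵐ x, f x = c * ((‖f x‖ : ℝ) : ℂ) := by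
  by_cases hf0 : f = 0
  · refine ⟨1, norm_one, ?_⟩
    filter_upwards [(Lp.eq_zero_iff_ae_eq_zero).mp hf0] with x hx
    simp [hx]
  have : Nonempty (Fin n) := ⟨⟨0, hn⟩⟩
  obtain ⟨k, hk0, hkt, hk⟩ := exists_gagliardo_eq hn hδ0 hδ1
  have hfm := L2.measurable f
  have hfin := hf.energy_lt_top hδ0.le hδ1.le
  have heq : energy δ (absL2 f) = energy δ f := by
    rw [hf.modulus hn hδ0 hδ1, norm_absL2, ← hf]
  have hfin' : moment δ (𝓕 f : L2 n) < ⊤ := lt_of_le_of_lt le_add_self hfin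
  have h1 : moment δ (𝓕 (absL2 f) : L2 n) = moment δ (𝓕 f : L2 n) := by
    rw [energy, energy, moment_absL2] at heq
    exact (ENNReal.add_right_inj (lt_of_le_of_lt le_self_add hfin).ne).mp heq
  have h2 : gagliardo δ (fun x => ((‖f x‖ : ℝ) : ℂ)) = gagliardo δ f := by
    rw [← gagliardo_congr_ae (absL2_ae f), hk, hk, h1]
  have hfin2 : gagliardo δ f ≠ ⊤ := by rw [hk]; exact ENNReal.mul_ne_top hkt hfin'.ne
  have hnm : Measurable fun x => ((‖f x‖ : ℝ) : ℂ) := Complex.measurable_ofReal.comp hfm.norm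
  -- Ordered integrands with equal finite integrals coincide, so ||f(y)|-|f(x)|| = |f(y)-f(x)| for
  -- almost every pair, the kernel being positive off the diagonal.
  have h3 := ae_eq_of_ae_le_of_lintegral_le
    (μ := (volume : Measure (Rn n)).prod volume)
    (Eventually.of_forall fun p : Rn n × Rn n => gagliardo_integrand_abs_le (δ := δ) f p.1 p.2)
    (by rw [← gagliardo_eq_lintegral_prod hnm, h2]; exact hfin2)
    (measurable_gagliardo_integrand hfm).aemeasurable
    (by rw [← gagliardo_eq_lintegral_prod hnm, ← gagliardo_eq_lintegral_prod hfm, h2])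
  have h4 := Measure.ae_ae_of_ae_prod h3
  have h5 : ∃ᵐ x, f x ≠ 0 := by
    intro h
    refine hf0 (Lp.eq_zero_iff_ae_eq_zero.mpr ?_)
    filter_upwards [h] with x hx
    simpa using hx
  -- One base point with f(x) ≠ 0 suffices: equality in the reverse triangle inequality puts almost
  -- every f(y) on the ray through f(x), whose direction is the phase.
  obtain ⟨x, hx0, hx⟩ := (h5.and_eventually h4).exists
  have hpos : 0 < ‖f x‖ := norm_pos_iff.mpr hx0
  have hne : ∀ᵐ y : Rn n, y ≠ x := by simp [ae_iff]
  refine ⟨f x / ((‖f x‖ : ℝ) : ℂ), by simp [hpos.ne'], ?_⟩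
  filter_upwards [hx, hne] with y hy hyx
  have hkpos := gagliardoKernel_pos (n := n) (δ := δ) (sub_ne_zero.mpr hyx)
  have h6 := (ENNReal.ofReal_eq_ofReal_iff (by positivity) (by positivity)).mp hy
  have h7 := mul_right_cancel₀ hkpos.ne' h6
  have h8 := (pow_left_inj₀ (norm_nonneg _) (norm_nonneg _) two_ne_zero).mp h7
  rw [← Complex.ofReal_sub, Complex.norm_real, Real.norm_eq_abs] at h8
  have h9 := sameRay_iff_norm_smul_eq.mp (sameRay_iff_norm_sub.mpr h8.symm)
  rw [Complex.real_smul, Complex.real_smul] at h9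
  have hc : ((‖f x‖ : ℝ) : ℂ) ≠ 0 := by exact_mod_cast hpos.ne'
  field_simp
  linear_combination -h9

theorem L2.eq_of_norm_le_of_norm_eq {f g : L2 n} (hfg : ∀ᵐ x, ‖f x‖ ≤ ‖g x‖) (h : ‖f‖ = ‖g‖) :
    ∀ᵐ x, ‖f x‖ = ‖g x‖ := by
  have h1 := ae_eq_of_ae_le_of_lintegral_le (μ := volume)
    (f := fun x => ENNReal.ofReal (‖f x‖ ^ 2)) (g := fun x => ENNReal.ofReal (‖g x‖ ^ 2))
    (by
      filter_upwards [hfg] with x hx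
      gcongr)
    (by rw [lintegral_norm_sq]; exact ENNReal.ofReal_ne_top)
    (ENNReal.measurable_ofReal.comp ((L2.measurable g).norm.pow_const 2)).aemeasurable
    (by rw [lintegral_norm_sq, lintegral_norm_sq, h])
  filter_upwards [h1] with x hx
  exact (pow_left_inj₀ (norm_nonneg _) (norm_nonneg _) two_ne_zero).mp
    ((ENNReal.ofReal_eq_ofReal_iff (by positivity) (by positivity)).mp hx)

/-- Nonnegative ground states of the same norm coincide. -/
theorem IsGround.eq_of_nonneg (hn : 0 < n) (hδ0 : 0 < δ) (hδ1 : δ < 1) {f g : L2 n}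
    (hf : IsGround δ f) (hg : IsGround δ g) (hf0 : ∀ᵐ x, f x = ((‖f x‖ : ℝ) : ℂ))
    (hg0 : ∀ᵐ x, g x = ((‖g x‖ : ℝ) : ℂ)) (hfg : ‖f‖ = ‖g‖) : f = g := by
  by_contra hne
  -- The difference is itself a ground state, so it has constant phase. It is real and nonzero, so
  -- the phase is real and one function dominates the other; equal norms then force equality.
  obtain ⟨c, hc1, hc⟩ := (hf.sub hg hδ0.le hδ1.le).exists_phase hn hδ0 hδ1
  have hval : ∀ᵐ x, (f - g : L2 n) x = ((‖f x‖ - ‖g x‖ : ℝ) : ℂ) := by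
    filter_upwards [Lp.coeFn_sub f g, hf0, hg0] with x h1 h2 h3
    rw [h1, Pi.sub_apply, h2, h3]
    simp
  have h5 : ∃ᵐ x, (f - g : L2 n) x ≠ 0 := by
    intro h
    refine hne (sub_eq_zero.mp (Lp.eq_zero_iff_ae_eq_zero.mpr ?_))
    filter_upwards [h] with x hx
    simpa using hx
  have hreal : ∃ r : ℝ, c = r := by
    obtain ⟨x, hx0, h1, h2⟩ := (h5.and_eventually (hc.and hval)).exists
    have hpos : ((‖(f - g : L2 n) x‖ : ℝ) : ℂ) ≠ 0 := by simpa using hx0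
    refine ⟨(‖f x‖ - ‖g x‖) / ‖(f - g : L2 n) x‖, ?_⟩
    rw [Complex.ofReal_div, eq_div_iff hpos, ← h1, h2]
  obtain ⟨r, rfl⟩ := hreal
  have hr : ∀ᵐ x, ‖f x‖ - ‖g x‖ = r * ‖(f - g : L2 n) x‖ := by
    filter_upwards [hc, hval] with x h1 h2
    rw [h2, ← Complex.ofReal_mul] at h1
    rw [h2]
    exact_mod_cast h1
  have key : ∀ᵐ x, ‖f x‖ = ‖g x‖ := by
    rcases le_total 0 r with h | h
    · have h1 := L2.eq_of_norm_le_of_norm_eq (f := g) (g := f) (by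
        filter_upwards [hr] with x hx
        have : 0 ≤ r * ‖(f - g : L2 n) x‖ := by positivity
        linarith) hfg.symm
      exact h1.mono fun x hx => hx.symm
    · exact L2.eq_of_norm_le_of_norm_eq (by
        filter_upwards [hr] with x hx
        have := mul_nonpos_of_nonpos_of_nonneg h (norm_nonneg ((f - g : L2 n) x))
        linarith) hfg
  refine hne (Lp.ext ?_)
  filter_upwards [key, hf0, hg0] with x h1 h2 h3
  rw [h2, h3, h1]

/-! ### Strict positivity of nonnegative ground states -/

theorem norm_ofReal_sub_ofReal_sq (a b : ℝ) : ‖((a : ℝ) : ℂ) - ((b : ℝ) : ℂ)‖ ^ 2 = (a - b) ^ 2 := by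
  rw [← Complex.ofReal_sub, Complex.norm_real, Real.norm_eq_abs, sq_abs]

/-- The interaction `∬ (g - f)₊(x) (f - g)₊(y) |y - x|^{-(n+2δ)} dx dy`. -/
def crossTerm (δ : ℝ) (f g : Rn n → ℝ) : ℝ≥0∞ :=
  ∫⁻ x, ∫⁻ y, ENNReal.ofReal
    (max (g x - f x) 0 * max (f y - g y) 0 * gagliardoKernel n δ (y - x))

/-- Nothing changes when both pairs are ordered alike. When the order is reversed, the sum of
squares drops by twice the product of the gaps; only the reversal with a ≤ b and b' ≤ a' is
recorded. -/
theorem sq_max_sub_add_sq_min_sub_le (a a' b b' : ℝ) :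
    (max a' b' - max a b) ^ 2 + (min a' b' - min a b) ^ 2 + 2 * (max (b - a) 0 * max (a' - b') 0) ≤
      (a' - a) ^ 2 + (b' - b) ^ 2 := by
  rcases le_total a b with h | h <;> rcases le_total a' b' with h' | h'
  · rw [max_eq_right h, max_eq_right h', min_eq_left h, min_eq_left h',
      max_eq_right (sub_nonpos.mpr h')]
    linarith
  · rw [max_eq_right h, max_eq_left h', min_eq_left h, min_eq_right h',
      max_eq_left (sub_nonneg.mpr h'), max_eq_left (sub_nonneg.mpr h)]
    linarith
  · rw [max_eq_left h, max_eq_right h', min_eq_right h, min_eq_left h',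
      max_eq_right (sub_nonpos.mpr h')]
    nlinarith [mul_nonneg (sub_nonneg.mpr h) (sub_nonneg.mpr h')]
  · rw [max_eq_left h, max_eq_left h', min_eq_right h, min_eq_right h',
      max_eq_right (sub_nonpos.mpr h)]
    linarith

theorem gagliardo_sup_add_inf_le {f g : Rn n → ℝ} (hf : Measurable f) (hg : Measurable g) :
    gagliardo δ (fun x => ((max (f x) (g x) : ℝ) : ℂ)) +
      gagliardo δ (fun x => ((min (f x) (g x) : ℝ) : ℂ)) + 2 * crossTerm δ f g ≤
    gagliardo δ (fun x => ((f x : ℝ) : ℂ)) + gagliardo δ (fun x => ((g x : ℝ) : ℂ)) := by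
  have hc : Measurable (fun p : Rn n × Rn n => ENNReal.ofReal
      (max (g p.1 - f p.1) 0 * max (f p.2 - g p.2) 0 * gagliardoKernel n δ (p.2 - p.1))) := by
    refine ENNReal.measurable_ofReal.comp (Measurable.mul (Measurable.mul ?_ ?_) ?_)
    · exact ((hg.comp measurable_fst).sub (hf.comp measurable_fst)).max measurable_const
    · exact ((hf.comp measurable_snd).sub (hg.comp measurable_snd)).max measurable_const
    · exact measurable_gagliardoKernel.comp (measurable_snd.sub measurable_fst)
  have hcross : crossTerm δ f g = ∫⁻ p : Rn n × Rn n, ENNReal.ofReal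
      (max (g p.1 - f p.1) 0 * max (f p.2 - g p.2) 0 * gagliardoKernel n δ (p.2 - p.1))
        ∂((volume : Measure (Rn n)).prod volume) := by
    rw [lintegral_prod _ hc.aemeasurable]; rfl
  have m1 : Measurable fun x => ((max (f x) (g x) : ℝ) : ℂ) :=
    Complex.measurable_ofReal.comp (hf.max hg)
  have m2 : Measurable fun x => ((min (f x) (g x) : ℝ) : ℂ) :=
    Complex.measurable_ofReal.comp (hf.min hg)
  have m3 : Measurable fun x => ((f x : ℝ) : ℂ) := Complex.measurable_ofReal.comp hf
  have m4 : Measurable fun x => ((g x : ℝ) : ℂ) := Complex.measurable_ofReal.comp hg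
  rw [add_assoc, hcross, gagliardo_eq_lintegral_prod m1, gagliardo_eq_lintegral_prod m2,
    gagliardo_eq_lintegral_prod m3, gagliardo_eq_lintegral_prod m4,
    ← lintegral_const_mul' _ _ (by norm_num),
    ← lintegral_add_left (measurable_gagliardo_integrand m2),
    ← lintegral_add_left (measurable_gagliardo_integrand m1),
    ← lintegral_add_left (measurable_gagliardo_integrand m3)]
  refine lintegral_mono fun p => ?_
  have hk := gagliardoKernel_nonneg (n := n) (δ := δ) (p.2 - p.1)
  simp only [norm_ofReal_sub_ofReal_sq]
  have h0 : 0 ≤ max (g p.1 - f p.1) 0 * max (f p.2 - g p.2) 0 :=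
    mul_nonneg (le_max_right _ _) (le_max_right _ _)
  rw [two_mul (ENNReal.ofReal _), ← ENNReal.ofReal_add (by positivity) (by positivity),
    ← ENNReal.ofReal_add (by positivity) (by positivity),
    ← ENNReal.ofReal_add (by positivity) (by positivity),
    ← ENNReal.ofReal_add (by positivity) (by positivity)]
  refine ENNReal.ofReal_le_ofReal ?_
  have := mul_le_mul_of_nonneg_right
    (sq_max_sub_add_sq_min_sub_le (f p.1) (f p.2) (g p.1) (g p.2)) hk
  linarith

theorem moment_sup_add_inf {f g : Rn n → ℝ} (hf : Measurable f) (hg : Measurable g) :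
    moment δ (fun x => ((max (f x) (g x) : ℝ) : ℂ)) +
      moment δ (fun x => ((min (f x) (g x) : ℝ) : ℂ)) =
    moment δ (fun x => ((f x : ℝ) : ℂ)) + moment δ (fun x => ((g x : ℝ) : ℂ)) := by
  simp only [moment]
  rw [← lintegral_add_left (by fun_prop), ← lintegral_add_left (by fun_prop)]
  refine lintegral_congr fun x => ?_
  simp only [Complex.norm_real, Real.norm_eq_abs, sq_abs]
  rcases le_total (f x) (g x) with h | h
  · rw [max_eq_right h, min_eq_left h, add_comm]
  · rw [max_eq_left h, min_eq_right h]

/-- The energy decreases under `(f, g) ↦ (f ⊔ g, f ⊓ g)`, with a quantitative gain. -/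
theorem energy_sup_add_inf_le {c : ℝ≥0∞}
    (hc : ∀ f : L2 n, gagliardo δ f = c * moment δ (𝓕 f : L2 n)) {f g : Rn n → ℝ}
    (hf : Measurable f) (hg : Measurable g) {F G U V : L2 n}
    (hF : F =ᵐ[volume] fun x => ((f x : ℝ) : ℂ)) (hG : G =ᵐ[volume] fun x => ((g x : ℝ) : ℂ))
    (hU : U =ᵐ[volume] fun x => ((max (f x) (g x) : ℝ) : ℂ))
    (hV : V =ᵐ[volume] fun x => ((min (f x) (g x) : ℝ) : ℂ)) :
    c * energy δ U + c * energy δ V + 2 * crossTerm δ f g ≤ c * energy δ F + c * energy δ G := by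
  have hm : ∀ {A : L2 n} {a : Rn n → ℂ}, A =ᵐ[volume] a → moment δ A = moment δ a := fun h =>
    moment_congr_norm_ae (h.mono fun x hx => by rw [hx])
  have h1 := gagliardo_sup_add_inf_le (δ := δ) hf hg
  rw [← gagliardo_congr_ae hF, ← gagliardo_congr_ae hG, ← gagliardo_congr_ae hU,
    ← gagliardo_congr_ae hV, hc, hc, hc, hc] at h1
  have h2 := moment_sup_add_inf (δ := δ) hf hg
  rw [← hm hF, ← hm hG, ← hm hU, ← hm hV] at h2
  simp only [energy]
  calc c * (moment δ U + moment δ (𝓕 U : L2 n)) + c * (moment δ V + moment δ (𝓕 V : L2 n)) +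
        2 * crossTerm δ f g
      = c * (moment δ U + moment δ V) + (c * moment δ (𝓕 U : L2 n) + c * moment δ (𝓕 V : L2 n) +
        2 * crossTerm δ f g) := by ring
    _ ≤ c * (moment δ F + moment δ G) +
        (c * moment δ (𝓕 F : L2 n) + c * moment δ (𝓕 G : L2 n)) := by
        rw [h2]; gcongr
    _ = _ := by ring

/-- Pointwise |F|² ≤ |F-G|² + 2|F||G|. The error is linear in G, which permits a bound by the `L¹`
norm. -/
theorem moment_le_moment_sub_add (F G : L2 n) :
    moment δ F ≤ moment δ (F - G : L2 n) +
      ∫⁻ x, ENNReal.ofReal (2 * (‖x‖ ^ (2 * δ) * ‖F x‖) * ‖G x‖) := by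
  rw [moment, moment, ← lintegral_add_left (measurable_moment_integrand δ _)]
  refine lintegral_mono_ae ?_
  filter_upwards [Lp.coeFn_sub F G] with x hx
  rw [hx, Pi.sub_apply, ← ENNReal.ofReal_add (by positivity) (by positivity)]
  refine ENNReal.ofReal_le_ofReal ?_
  have h1 : ‖F x‖ - ‖G x‖ ≤ ‖F x - G x‖ := norm_sub_norm_le _ _
  have h2 : ‖G x‖ - ‖F x‖ ≤ ‖F x - G x‖ := by rw [norm_sub_rev]; exact norm_sub_norm_le _ _
  have h3 : (‖F x‖ - ‖G x‖) ^ 2 ≤ ‖F x - G x‖ ^ 2 := sq_le_sq' (by linarith) h1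
  have h4 : 0 ≤ ‖x‖ ^ (2 * δ) := by positivity
  have h5 : ‖F x‖ ^ 2 ≤ ‖F x - G x‖ ^ 2 + 2 * ‖F x‖ * ‖G x‖ := by nlinarith [sq_nonneg ‖G x‖]
  calc _ ≤ ‖x‖ ^ (2 * δ) * (‖F x - G x‖ ^ 2 + 2 * ‖F x‖ * ‖G x‖) := mul_le_mul_of_nonneg_left h5 h4
    _ = _ := by ring

theorem norm_fourier_le_of_integrable (G : L2 n) (hG : Integrable G volume) :
    ∀ᵐ ξ, ‖(𝓕 G : L2 n) ξ‖ ≤ ∫ x, ‖G x‖ := by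
  filter_upwards [fourier_ae_eq_of_integrable G hG] with ξ hξ
  rw [hξ]
  exact VectorFourier.norm_fourierIntegral_le_integral_norm _ _ _ _ _

/-- Perturbing a Schwartz function by an integrable function changes the energy by at most a
multiple of the `L¹` norm of the perturbation. -/
theorem energy_schwartz_le (φ : 𝓢(Rn n, ℂ)) (hδ0 : 0 ≤ δ) (hδ1 : δ ≤ 1) {K : ℝ} (hK0 : 0 ≤ K)
    (hK : ∀ x, ‖x‖ ^ (2 * δ) * ‖φ x‖ ≤ K) (G : L2 n) (hG : Integrable G volume) :
    energy δ (φ.toLp 2 volume : L2 n) ≤ energy δ (φ.toLp 2 volume - G : L2 n) +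
      ENNReal.ofReal (2 * (K + ∫ ξ, ‖ξ‖ ^ (2 * δ) * ‖𝓕 φ ξ‖) * ∫ x, ‖G x‖) := by
  have hI : 0 ≤ ∫ x, ‖G x‖ := integral_nonneg fun x => norm_nonneg _
  have hJ : 0 ≤ ∫ ξ, ‖ξ‖ ^ (2 * δ) * ‖𝓕 φ ξ‖ := integral_nonneg fun x => by positivity
  have h1 := moment_le_moment_sub_add (δ := δ) (φ.toLp 2 volume) G
  have h2 := moment_le_moment_sub_add (δ := δ) (𝓕 (φ.toLp 2 volume : L2 n)) (𝓕 G)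
  rw [← fourier_sub_L2] at h2
  have h3 : ∫⁻ x, ENNReal.ofReal (2 * (‖x‖ ^ (2 * δ) * ‖(φ.toLp 2 volume : L2 n) x‖) * ‖G x‖) ≤
      ENNReal.ofReal (2 * K * ∫ x, ‖G x‖) := by
    rw [ENNReal.ofReal_mul (by positivity), ofReal_integral_eq_lintegral_ofReal hG.norm
      (Eventually.of_forall fun x => norm_nonneg _), ← lintegral_const_mul' _ _ ENNReal.ofReal_ne_top]
    refine lintegral_mono_ae ?_
    filter_upwards [SchwartzMap.coeFn_toLp φ 2 volume] with x hx
    rw [hx, ← ENNReal.ofReal_mul (by positivity)]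
    have := hK x
    gcongr
  -- On the frequency side the transform of G is bounded by ‖G‖₁, and the weighted transform of φ is
  -- integrable.
  have h4 : ∫⁻ ξ, ENNReal.ofReal (2 * (‖ξ‖ ^ (2 * δ) * ‖(𝓕 (φ.toLp 2 volume : L2 n) : L2 n) ξ‖) *
      ‖(𝓕 G : L2 n) ξ‖) ≤
      ENNReal.ofReal (2 * (∫ ξ, ‖ξ‖ ^ (2 * δ) * ‖𝓕 φ ξ‖) * ∫ x, ‖G x‖) := by
    rw [mul_right_comm, ENNReal.ofReal_mul (by positivity), ofReal_integral_eq_lintegral_ofReal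
      (SchwartzMap.integrable_rpow_mul_norm (𝓕 φ) (by positivity) (by linarith))
      (Eventually.of_forall fun x => by positivity), ← lintegral_const_mul' _ _ ENNReal.ofReal_ne_top]
    refine lintegral_mono_ae ?_
    rw [SchwartzMap.toLp_fourier_eq]
    filter_upwards [SchwartzMap.coeFn_toLp (𝓕 φ) 2 volume, norm_fourier_le_of_integrable G hG]
      with ξ h5 h6
    rw [h5, ← ENNReal.ofReal_mul (by positivity), mul_right_comm]
    gcongr
  have h5 : 2 * (K + ∫ ξ, ‖ξ‖ ^ (2 * δ) * ‖𝓕 φ ξ‖) * ∫ x, ‖G x‖ =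
      2 * K * (∫ x, ‖G x‖) + 2 * (∫ ξ, ‖ξ‖ ^ (2 * δ) * ‖𝓕 φ ξ‖) * ∫ x, ‖G x‖ := by ring
  rw [h5, ENNReal.ofReal_add (by positivity) (by positivity)]
  simp only [energy]
  calc _ ≤ _ := add_le_add h1 h2
    _ ≤ _ := add_le_add (add_le_add_right h3 _) (add_le_add_right h4 _)
    _ = _ := by ring

/-- A lower bound for the interaction when `g` vanishes outside of a ball. -/
theorem mul_lintegral_le_crossTerm (hn : 0 < n) (hδ : 0 ≤ δ) {f g h : Rn n → ℝ} {R : ℝ}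
    (hf : ∀ x, 0 ≤ f x) (hgR : ∀ x, R ≤ ‖x‖ → g x = 0) (hgh : ∀ x, g x ≤ h x) :
    (∫⁻ y, ENNReal.ofReal (max (f y - h y) 0 * (‖y‖ + R) ^ (-((n : ℝ) + 2 * δ)))) *
      (∫⁻ x, ENNReal.ofReal (max (g x - f x) 0)) ≤ crossTerm δ f g := by
  have : Nonempty (Fin n) := ⟨⟨0, hn⟩⟩
  set m := ∫⁻ y, ENNReal.ofReal (max (f y - h y) 0 * (‖y‖ + R) ^ (-((n : ℝ) + 2 * δ)))
  refine le_trans (lintegral_const_mul_le _ _) (lintegral_mono fun x => ?_)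
  rw [mul_comm]
  have hmul : ENNReal.ofReal (max (g x - f x) 0) * m = ∫⁻ y, ENNReal.ofReal (max (g x - f x) 0) *
      ENNReal.ofReal (max (f y - h y) 0 * (‖y‖ + R) ^ (-((n : ℝ) + 2 * δ))) :=
    (lintegral_const_mul' _ _ ENNReal.ofReal_ne_top).symm
  rw [hmul]
  refine lintegral_mono_ae ?_
  have hne : ∀ᵐ y : Rn n, y ≠ x := by simp [ae_iff]
  filter_upwards [hne] with y hyx
  rw [← ENNReal.ofReal_mul (le_max_right _ _)]
  refine ENNReal.ofReal_le_ofReal ?_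
  rw [mul_assoc]
  -- Inside the ball |y-x| ≤ |y| + R bounds the kernel below independently of x; outside, g vanishes
  -- and so does (g-f)₊.
  rcases lt_or_ge ‖x‖ R with hx | hx
  · refine mul_le_mul_of_nonneg_left ?_ (le_max_right _ _)
    have h1 : max (f y - h y) 0 ≤ max (f y - g y) 0 := by
      have := hgh y
      gcongr
    have h2 : (‖y‖ + R) ^ (-((n : ℝ) + 2 * δ)) ≤ gagliardoKernel n δ (y - x) := by
      refine Real.rpow_le_rpow_of_nonpos (norm_pos_iff.mpr (sub_ne_zero.mpr hyx)) ?_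
        (by have : (0 : ℝ) ≤ n := n.cast_nonneg; linarith)
      have := norm_sub_le y x
      linarith
    have h3 : 0 ≤ ‖y‖ + R := by have := norm_nonneg y; have := norm_nonneg x; linarith
    exact mul_le_mul h1 h2 (by positivity) (le_max_right _ _)
  · have : max (g x - f x) 0 = 0 := by
      rw [hgR x hx]
      exact max_eq_right (by linarith [hf x])
    rw [this, zero_mul, zero_mul]

/-- If the integral vanished for every ε = 1/(k+1), then q ≤ 1/(k+1) almost everywhere for all k,
hence q ≤ 0. -/
theorem exists_lintegral_pos {q : Rn n → ℝ} (hqm : Measurable q) (hq : ¬ ∀ᵐ x, q x ≤ 0)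
    {b : Rn n → ℝ} (hbm : Measurable b) (hb1 : ∀ x, b x ≤ 1) {R : ℝ} (hR : 0 < R) (a : ℝ) :
    ∃ ε : ℝ, 0 < ε ∧
      ∫⁻ y, ENNReal.ofReal (max (q y - ε * b y) 0 * (‖y‖ + R) ^ a) ≠ 0 := by
  by_contra! hcon
  refine hq ?_
  have h1 : ∀ k : ℕ, ∀ᵐ x, q x ≤ 1 / ((k : ℝ) + 1) := by
    intro k
    have h2 := hcon (1 / ((k : ℝ) + 1)) (by positivity)
    rw [lintegral_eq_zero_iff (by fun_prop)] at h2
    filter_upwards [h2] with x hx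
    have h3 := ENNReal.ofReal_eq_zero.mp hx
    have h4 : 0 < (‖x‖ + R) ^ a := Real.rpow_pos_of_pos (by positivity) _
    have h5 : max (q x - 1 / ((k : ℝ) + 1) * b x) 0 ≤ 0 := by
      by_contra h6
      exact absurd h3 (not_le.mpr (mul_pos (not_le.mp h6) h4))
    have h6 := (le_max_left _ _).trans h5
    have h7 : 1 / ((k : ℝ) + 1) * b x ≤ 1 / ((k : ℝ) + 1) :=
      mul_le_of_le_one_right (by positivity) (hb1 x)
    linarith
  filter_upwards [ae_all_iff.mpr h1] with x hx
  exact ge_of_tendsto' tendsto_one_div_add_atTop_nhds_zero_nat hx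

/-- A nonnegative ground state is bounded below by a positive multiple of a bump function. -/
theorem IsGround.exists_mul_bump_le (hn : 0 < n) (hδ0 : 0 < δ) (hδ1 : δ < 1) {Q : L2 n}
    (hQ : IsGround δ Q) (hQ0 : Q ≠ 0) (hnn : ∀ᵐ x, Q x = ((‖Q x‖ : ℝ) : ℂ))
    (η : 𝓢(Rn n, ℂ)) {b : Rn n → ℝ} (hη : ∀ x, η x = b x) (hb0 : ∀ x, 0 ≤ b x)
    (hb1 : ∀ x, b x ≤ 1) {R : ℝ} (hR : 0 < R) (hbR : ∀ x, R ≤ ‖x‖ → b x = 0) :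
    ∃ ε : ℝ, 0 < ε ∧ ∀ᵐ x, ε * b x ≤ ‖Q x‖ := by
  obtain ⟨c, hc0, hct, hc⟩ := exists_gagliardo_eq hn hδ0 hδ1
  have hqm : Measurable fun x => ‖Q x‖ := (L2.measurable Q).norm
  have hbre : b = fun x => (η x).re := by funext x; rw [hη]; simp
  have hbm : Measurable b := by rw [hbre]; exact (Complex.continuous_re.comp η.continuous).measurable
  have hnorm : ∀ x, ‖η x‖ = b x := fun x => by
    rw [hη, Complex.norm_real, Real.norm_of_nonneg (hb0 x)]
  -- The mass `m` of Q above ε₀b is fixed first: it bounds the interaction below uniformly for all ε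
  -- ≤ ε₀.
  obtain ⟨ε₀, hε₀, hm⟩ := exists_lintegral_pos hqm (fun h => hQ0 (by
    rw [Lp.eq_zero_iff_ae_eq_zero]
    filter_upwards [h] with x hx
    exact norm_le_zero_iff.mp hx)) hbm hb1 hR (-((n : ℝ) + 2 * δ))
  set m := ∫⁻ y, ENNReal.ofReal (max (‖Q y‖ - ε₀ * b y) 0 * (‖y‖ + R) ^ (-((n : ℝ) + 2 * δ)))
  set K : ℝ := R ^ (2 * δ) with hK
  have hKη : ∀ x, ‖x‖ ^ (2 * δ) * ‖η x‖ ≤ K := by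
    intro x
    rw [hnorm]
    rcases lt_or_ge ‖x‖ R with hx | hx
    · have h1 : ‖x‖ ^ (2 * δ) ≤ K := Real.rpow_le_rpow (norm_nonneg _) hx.le (by positivity)
      exact (mul_le_mul h1 (hb1 x) (hb0 x) (by positivity)).trans (by rw [mul_one])
    · rw [hbR x hx, mul_zero]; positivity
  set J : ℝ := ∫ ξ, ‖ξ‖ ^ (2 * δ) * ‖𝓕 η ξ‖ with hJ
  have hlim : Tendsto (fun ε : ℝ => c * ENNReal.ofReal (ε * (K + J))) (𝓝[>] 0) (𝓝 0) := by
    have h1 : Tendsto (fun ε : ℝ => ε * (K + J)) (𝓝[>] 0) (𝓝 0) := by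
      have h2 : Continuous fun ε : ℝ => ε * (K + J) := by fun_prop
      simpa using (h2.tendsto 0).mono_left nhdsWithin_le_nhds
    have h2 := ENNReal.Tendsto.const_mul (ENNReal.tendsto_ofReal h1) (Or.inr hct)
    simpa using h2
  -- Now ε ≤ ε₀ is chosen so small that the cost coefficient cε(K+J) is strictly below `m`.
  obtain ⟨ε, ⟨hε1, hε2⟩, hε⟩ := (((hlim.eventually_lt_const (pos_iff_ne_zero.mpr hm)).and
    ((eventually_le_nhds hε₀).filter_mono nhdsWithin_le_nhds)).and self_mem_nhdsWithin).exists
  have hε : 0 < ε := hε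
  refine ⟨ε, hε, ?_⟩
  set ηε : 𝓢(Rn n, ℂ) := (ε : ℂ) • η with hηε
  have hηε_val : ∀ x, ηε x = ((ε * b x : ℝ) : ℂ) := by
    intro x; simp [hηε, hη]
  set g : Rn n → ℝ := fun x => ε * b x with hg
  have hgm : Measurable g := hbm.const_mul ε
  have hG : (ηε.toLp 2 volume : L2 n) =ᵐ[volume] fun x => ((g x : ℝ) : ℂ) := by
    filter_upwards [SchwartzMap.coeFn_toLp ηε 2 volume] with x hx
    rw [hx, hηε_val]
  have hgL : MemLp g 2 volume := by
    have h1 := ((ηε.memLp 2 volume).re)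
    refine h1.ae_eq (Eventually.of_forall fun x => ?_)
    simp [hηε_val, hg]
  have hqL : MemLp (fun x => ‖Q x‖) 2 volume := (Lp.memLp Q).norm
  have hUL : MemLp (fun x => ((max ‖Q x‖ (g x) : ℝ) : ℂ)) 2 volume := (hqL.sup hgL).ofReal
  have hVL : MemLp (fun x => ((min ‖Q x‖ (g x) : ℝ) : ℂ)) 2 volume := (hqL.inf hgL).ofReal
  set U : L2 n := hUL.toLp _ with hU
  set V : L2 n := hVL.toLp _ with hV
  set G : L2 n := ηε.toLp 2 volume with hGdef
  have hUae := hUL.coeFn_toLp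
  have hVae := hVL.coeFn_toLp
  have h1 := energy_sup_add_inf_le (δ := δ) hc hqm hgm hnn hG hUae hVae
  have hEfin : energy δ Q ≠ ⊤ := (hQ.energy_lt_top hδ0.le hδ1.le).ne
  have hGfin : energy δ G ≠ ⊤ := (energy_schwartz_lt_top ηε hδ0.le hδ1.le).ne
  -- The maximum U has norm at least that of Q, and Q is a ground state. Thus E(Q) cancels from the
  -- max-min inequality, leaving the interaction bounded by the energy gap between G and V.
  have hQU : energy δ Q ≤ energy δ U := by
    refine le_trans ?_ (groundEnergy_mul_le U)
    rw [hQ]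
    have : ‖Q‖ ≤ ‖U‖ := by
      refine Lp.norm_le_norm_of_ae_le ?_
      filter_upwards [hUae] with x hx
      rw [hx, Complex.norm_real]
      exact (le_max_left _ _).trans (le_abs_self _)
    gcongr
  have h2 : c * energy δ V + 2 * crossTerm δ (fun x => ‖Q x‖) g ≤ c * energy δ G := by
    have h3 : c * energy δ Q + (c * energy δ V + 2 * crossTerm δ (fun x => ‖Q x‖) g) ≤
        c * energy δ Q + c * energy δ G := by
      refine le_trans ?_ h1
      rw [← add_assoc]
      gcongr
    exact (ENNReal.add_le_add_iff_left (ENNReal.mul_ne_top hct hEfin)).mp h3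
  have hVfin : c * energy δ V ≠ ⊤ :=
    ne_top_of_le_ne_top (ENNReal.mul_ne_top hct hGfin) (le_self_add.trans h2)
  -- P = (g-Q)₊ is the part of the bump above Q, and its `L¹` norm N is the quantity to be shown
  -- zero.
  set P : L2 n := G - V with hP
  have hPae : ∀ᵐ x, ‖P x‖ = max (g x - ‖Q x‖) 0 := by
    filter_upwards [Lp.coeFn_sub G V, hG, hVae] with x h3 h4 h5
    rw [h3, Pi.sub_apply, h4, h5, ← Complex.ofReal_sub, Complex.norm_real]
    rcases le_total ‖Q x‖ (g x) with h | h
    · rw [min_eq_left h, max_eq_left (sub_nonneg.mpr h), Real.norm_of_nonneg (sub_nonneg.mpr h)]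
    · rw [min_eq_right h, max_eq_right (sub_nonpos.mpr h), sub_self, norm_zero]
  have hPint : Integrable P volume := by
    refine (ηε.integrable (μ := volume)).mono (Lp.aestronglyMeasurable P) ?_
    filter_upwards [hPae] with x hx
    have hg0 : 0 ≤ g x := mul_nonneg hε.le (hb0 x)
    rw [hx, hηε_val, Complex.norm_real, Real.norm_of_nonneg hg0]
    exact max_le (by linarith [norm_nonneg (Q x)]) hg0
  have hNeq : ∫⁻ x, ENNReal.ofReal (max (g x - ‖Q x‖) 0) = ENNReal.ofReal (∫ x, ‖P x‖) := by
    rw [ofReal_integral_eq_lintegral_ofReal hPint.norm (Eventually.of_forall fun x => norm_nonneg _)]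
    refine lintegral_congr_ae ?_
    filter_upwards [hPae] with x hx
    rw [hx]
  have hcross := mul_lintegral_le_crossTerm (δ := δ) hn hδ0.le (f := fun x => ‖Q x‖) (g := g)
    (h := fun x => ε₀ * b x) (R := R) (fun x => norm_nonneg _)
    (fun x hx => by simp [hg, hbR x hx]) (fun x => mul_le_mul_of_nonneg_right hε2 (hb0 x))
  rw [hNeq] at hcross
  have h3 := energy_schwartz_le ηε hδ0.le hδ1.le (K := ε * K) (by positivity) (fun x => by
    have : ‖ηε x‖ = ε * ‖η x‖ := by simp [hηε, abs_of_pos hε]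
    rw [this, mul_left_comm]
    exact mul_le_mul_of_nonneg_left (hKη x) hε.le) P hPint
  have hJε : ∫ ξ, ‖ξ‖ ^ (2 * δ) * ‖𝓕 ηε ξ‖ = ε * J := by
    rw [hJ, ← integral_const_mul]
    refine integral_congr_ae (Eventually.of_forall fun ξ => ?_)
    have : ‖𝓕 ηε ξ‖ = ε * ‖𝓕 η ξ‖ := by
      rw [hηε, FourierTransform.fourier_smul]
      simp [abs_of_pos hε]
    simp only [this]; ring
  rw [hJε, show ηε.toLp 2 volume - P = V by rw [hP]; abel, ← mul_add] at h3
  set N : ℝ := ∫ x, ‖P x‖ with hN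
  have hN0 : 0 ≤ N := integral_nonneg fun x => norm_nonneg _
  have h4 : 2 * crossTerm δ (fun x => ‖Q x‖) g ≤ c * ENNReal.ofReal (2 * (ε * (K + J)) * N) := by
    have h5 : c * energy δ V + 2 * crossTerm δ (fun x => ‖Q x‖) g ≤
        c * energy δ V + c * ENNReal.ofReal (2 * (ε * (K + J)) * N) := by
      refine h2.trans ?_
      rw [← mul_add]
      exact mul_le_mul_right h3 _
    exact (ENNReal.add_le_add_iff_left hVfin).mp h5
  have hJ0 : 0 ≤ J := integral_nonneg fun x => by positivity
  have h5 : m * ENNReal.ofReal N ≤ (c * ENNReal.ofReal (ε * (K + J))) * ENNReal.ofReal N := by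
    have h6 : 2 * (m * ENNReal.ofReal N) ≤
        2 * ((c * ENNReal.ofReal (ε * (K + J))) * ENNReal.ofReal N) := by
      refine (mul_le_mul_right hcross 2).trans (h4.trans (le_of_eq ?_))
      rw [ENNReal.ofReal_mul (by positivity), ENNReal.ofReal_mul (by norm_num)]
      simp only [ENNReal.ofReal_ofNat]
      ring
    exact (ENNReal.mul_le_mul_iff_right (by norm_num) (by norm_num)).mp h6
  -- The gain and cost estimates give mN ≤ cε(K+J)N, incompatible with cε(K+J) < m unless N = 0.
  have hNz : ENNReal.ofReal N = 0 := by
    by_contra hne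
    exact absurd ((ENNReal.mul_le_mul_iff_left hne ENNReal.ofReal_ne_top).mp h5) (not_le.mpr hε1)
  have hNz' : ∫ x, ‖P x‖ = 0 := le_antisymm (ENNReal.ofReal_eq_zero.mp hNz) hN0
  have h6 := (integral_eq_zero_iff_of_nonneg (fun x => norm_nonneg (P x)) hPint.norm).mp hNz'
  filter_upwards [h6, hPae] with x h7 h8
  have h9 : max (g x - ‖Q x‖) 0 = 0 := h8.symm.trans h7
  have := (le_max_left (g x - ‖Q x‖) 0).trans h9.le
  linarith

/-- A nonzero nonnegative ground state is positive almost everywhere. -/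
theorem IsGround.pos (hn : 0 < n) (hδ0 : 0 < δ) (hδ1 : δ < 1) {Q : L2 n}
    (hQ : IsGround δ Q) (hQ0 : Q ≠ 0) (hnn : ∀ᵐ x, Q x = ((‖Q x‖ : ℝ) : ℂ)) :
    ∀ᵐ x, 0 < ‖Q x‖ := by
  have h : ∀ k : ℕ, ∀ᵐ x : Rn n, ‖x‖ ≤ (k : ℝ) + 1 → 0 < ‖Q x‖ := by
    intro k
    obtain ⟨η, b, hη, hb0, hb1, hb, hbR⟩ := exists_schwartz_bump n
      (by positivity : 0 < (k : ℝ) + 1)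
    obtain ⟨ε, hε, h1⟩ := hQ.exists_mul_bump_le hn hδ0 hδ1 hQ0 hnn η hη hb0 hb1
      (by positivity) hbR
    filter_upwards [h1] with x hx hxk
    rw [hb x hxk, mul_one] at hx
    linarith
  filter_upwards [ae_all_iff.mpr h] with x hx
  obtain ⟨k, hk⟩ := exists_nat_ge ‖x‖
  exact hx k (by linarith)

/-! ### The static uncertainty principle -/

theorem MemSigma.moment_eq {f : L2 n} (hf : MemSigma δ f) :
    moment δ f = ENNReal.ofReal (weightNorm δ f ^ 2) := by
  rw [weightNorm_sq, ENNReal.ofReal_toReal ((memSigma_iff f).mp hf).1.ne]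

theorem MemSigma.moment_fourier_eq {f : L2 n} (hf : MemSigma δ f) :
    moment δ (𝓕 f : L2 n) = ENNReal.ofReal (fracDerivNorm δ f ^ 2) := by
  rw [fracDerivNorm_sq, ENNReal.ofReal_toReal ((memSigma_iff f).mp hf).2.ne]

theorem MemSigma.energy_eq {f : L2 n} (hf : MemSigma δ f) :
    energy δ f = ENNReal.ofReal (weightNorm δ f ^ 2 + fracDerivNorm δ f ^ 2) := by
  rw [energy, hf.moment_eq, hf.moment_fourier_eq,
    ENNReal.ofReal_add (by positivity) (by positivity)]

theorem memSigma_of_energy_lt_top {f : L2 n} (hf : energy δ f < ⊤) : MemSigma δ f :=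
  (memSigma_iff f).mpr (ENNReal.add_lt_top.mp hf)

theorem MemSigma.weightNorm_pos (hn : 0 < n) {f : L2 n} (hf : MemSigma δ f) (hf0 : f ≠ 0) :
    0 < weightNorm δ f := by
  refine lt_of_le_of_ne (weightNorm_nonneg f) fun h => hf0 ?_
  rw [← moment_eq_zero_iff (δ := δ) hn, hf.moment_eq, ← h]
  simp

theorem fourier_ne_zero {f : L2 n} (hf0 : f ≠ 0) : (𝓕 f : L2 n) ≠ 0 := by
  rw [← norm_ne_zero_iff, Lp.norm_fourier_eq]
  exact norm_ne_zero_iff.mpr hf0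

theorem MemSigma.fracDerivNorm_pos (hn : 0 < n) {f : L2 n} (hf : MemSigma δ f) (hf0 : f ≠ 0) :
    0 < fracDerivNorm δ f := by
  refine lt_of_le_of_ne (fracDerivNorm_nonneg f) fun h => fourier_ne_zero hf0 ?_
  rw [← moment_eq_zero_iff (δ := δ) hn, hf.moment_fourier_eq, ← h]
  simp

theorem moment_fourier_dilateL2 {s : ℝ} (hs : s ≠ 0) (f : L2 n) :
    moment δ (𝓕 (dilateL2 s hs f) : L2 n) =
      ENNReal.ofReal (|s| ^ (2 * δ)) * moment δ (𝓕 f : L2 n) := by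
  rw [fourier_dilateL2, moment_dilateL2, abs_inv, Real.inv_rpow (abs_nonneg _),
    Real.rpow_neg (abs_nonneg _), inv_inv]

/-- Dilating balances the two moments. -/
theorem MemSigma.exists_dilate_energy_eq (hn : 0 < n) (hδ : 0 < δ) {f : L2 n} (hf : MemSigma δ f)
    (hf0 : f ≠ 0) : ∃ (s : ℝ) (hs : 0 < s), energy δ (dilateL2 s hs.ne' f) =
      ENNReal.ofReal (2 * (weightNorm δ f * fracDerivNorm δ f)) := by
  have hw := hf.weightNorm_pos hn hf0
  have hd := hf.fracDerivNorm_pos hn hf0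
  set w := weightNorm δ f
  set d := fracDerivNorm δ f
  -- This s satisfies s^{2δ} = w/d, so both moments s^{-2δ}w² and s^{2δ}d² of the dilate equal wd.
  have hs : 0 < (w / d) ^ (1 / (2 * δ)) := by positivity
  refine ⟨(w / d) ^ (1 / (2 * δ)), hs, ?_⟩
  have h1 : ((w / d) ^ (1 / (2 * δ))) ^ (2 * δ) = w / d := by
    rw [← Real.rpow_mul (by positivity)]
    have : 1 / (2 * δ) * (2 * δ) = 1 := by field_simp
    rw [this, Real.rpow_one]
  rw [energy, moment_dilateL2, moment_fourier_dilateL2, hf.moment_eq, hf.moment_fourier_eq,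
    abs_of_pos hs, Real.rpow_neg hs.le, h1, ← ENNReal.ofReal_mul (by positivity),
    ← ENNReal.ofReal_mul (by positivity), ← ENNReal.ofReal_add (by positivity) (by positivity)]
  congr 1
  field_simp
  ring

theorem groundEnergy_le (f : L2 n) (hf : ‖f‖ = 1) : groundEnergy n δ ≤ energy δ f := by
  simpa [hf] using groundEnergy_mul_le (δ := δ) f

theorem isGround_iff {f : L2 n} (hf : ‖f‖ = 1) : IsGround δ f ↔ energy δ f = groundEnergy n δ := by
  simp [IsGround, hf]

theorem MemSigma.groundEnergy_le_two_mul (hn : 0 < n) (hδ : 0 < δ) {f : L2 n} (hf : MemSigma δ f)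
    (hf1 : ‖f‖ = 1) :
    (groundEnergy n δ).toReal ≤ 2 * (weightNorm δ f * fracDerivNorm δ f) := by
  have hf0 : f ≠ 0 := by rintro rfl; simp at hf1
  obtain ⟨s, hs, h⟩ := hf.exists_dilate_energy_eq hn hδ hf0
  have h1 := groundEnergy_le (δ := δ) (dilateL2 s hs.ne' f) (by rw [LinearIsometry.norm_map, hf1])
  rw [h] at h1
  exact ENNReal.toReal_le_of_le_ofReal
    (by have := weightNorm_nonneg (δ := δ) f; have := fracDerivNorm_nonneg (δ := δ) f; positivity) h1

/-- There is a positive unit ground state. -/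
theorem exists_pos_ground (hn : 0 < n) (hδ0 : 0 < δ) (hδ1 : δ < 1) :
    ∃ Q : L2 n, ‖Q‖ = 1 ∧ IsGround δ Q ∧ (∀ᵐ x, Q x = ((‖Q x‖ : ℝ) : ℂ)) ∧ ∀ᵐ x, 0 < ‖Q x‖ := by
  obtain ⟨f, hf1, hf⟩ := exists_ground_state (n := n) hδ0 hδ1
  have hfg : IsGround δ f := (isGround_iff hf1).mpr hf
  have h1 : ‖absL2 f‖ = 1 := by rw [norm_absL2, hf1]
  have h2 := hfg.modulus hn hδ0 hδ1
  have h3 : ∀ᵐ x, absL2 f x = ((‖absL2 f x‖ : ℝ) : ℂ) := by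
    filter_upwards [absL2_ae f] with x hx
    rw [hx]; simp
  exact ⟨absL2 f, h1, h2, h3, h2.pos hn hδ0 hδ1 (by intro h; simp [h] at h1) h3⟩

theorem IsGround.memSigma (hδ0 : 0 < δ) (hδ1 : δ < 1) {Q : L2 n} (hQ : IsGround δ Q) :
    MemSigma δ Q := memSigma_of_energy_lt_top (hQ.energy_lt_top hδ0.le hδ1.le)

theorem IsGround.sq_add_sq (hδ0 : 0 < δ) (hδ1 : δ < 1) {Q : L2 n} (hQ : IsGround δ Q)
    (hQ1 : ‖Q‖ = 1) :
    weightNorm δ Q ^ 2 + fracDerivNorm δ Q ^ 2 = (groundEnergy n δ).toReal := by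
  rw [← (isGround_iff hQ1).mp hQ, (hQ.memSigma hδ0 hδ1).energy_eq,
    ENNReal.toReal_ofReal (by positivity)]

/-- At a unit ground state 2wd ≤ w² + d² = E₀ ≤ 2wd, the last step by balancing dilation. So the
infimum of wd is attained and equals E₀/2. -/
theorem sharpConst_sq (hn : 0 < n) (hδ0 : 0 < δ) (hδ1 : δ < 1) :
    sharpConst n δ ^ 2 = (groundEnergy n δ).toReal / 2 := by
  obtain ⟨Q, hQ1, hQ, -, -⟩ := exists_pos_ground (n := n) hn hδ0 hδ1
  have hQS := hQ.memSigma hδ0 hδ1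
  have h1 := hQ.sq_add_sq hδ0 hδ1 hQ1
  have h2 := hQS.groundEnergy_le_two_mul hn hδ0 hQ1
  have h3 : weightNorm δ Q * fracDerivNorm δ Q = (groundEnergy n δ).toReal / 2 := by
    nlinarith [sq_nonneg (weightNorm δ Q - fracDerivNorm δ Q)]
  have h4 : IsLeast {r : ℝ | ∃ f : L2 n, MemSigma δ f ∧ ‖f‖ = 1 ∧
      r = weightNorm δ f * fracDerivNorm δ f} ((groundEnergy n δ).toReal / 2) := by
    refine ⟨⟨Q, hQS, hQ1, h3.symm⟩, ?_⟩
    rintro r ⟨f, hf, hf1, rfl⟩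
    have := hf.groundEnergy_le_two_mul hn hδ0 hf1
    linarith
  rw [sharpConst, h4.csInf_eq, Real.sq_sqrt (by positivity)]

/-- Equality in the arithmetic–geometric mean inequality: w² + d² = E₀ ≤ 2wd. -/
theorem IsGround.balanced (hn : 0 < n) (hδ0 : 0 < δ) (hδ1 : δ < 1) {Q : L2 n} (hQ : IsGround δ Q)
    (hQ1 : ‖Q‖ = 1) : weightNorm δ Q = fracDerivNorm δ Q := by
  have h1 := hQ.sq_add_sq hδ0 hδ1 hQ1
  have h2 := (hQ.memSigma hδ0 hδ1).groundEnergy_le_two_mul hn hδ0 hQ1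
  have h3 : (weightNorm δ Q - fracDerivNorm δ Q) ^ 2 = 0 :=
    le_antisymm (by nlinarith) (sq_nonneg _)
  exact sub_eq_zero.mp (pow_eq_zero_iff two_ne_zero |>.mp h3)

theorem IsGround.mul_eq_sharpConst_sq (hn : 0 < n) (hδ0 : 0 < δ) (hδ1 : δ < 1) {Q : L2 n}
    (hQ : IsGround δ Q) (hQ1 : ‖Q‖ = 1) :
    weightNorm δ Q * fracDerivNorm δ Q = sharpConst n δ ^ 2 := by
  have h1 := hQ.sq_add_sq hδ0 hδ1 hQ1
  rw [sharpConst_sq hn hδ0 hδ1, ← h1, hQ.balanced hn hδ0 hδ1 hQ1]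
  ring

theorem sharpConst_pos (hn : 0 < n) (hδ0 : 0 < δ) (hδ1 : δ < 1) : 0 < sharpConst n δ := by
  obtain ⟨Q, hQ1, hQ, -, -⟩ := exists_pos_ground (n := n) hn hδ0 hδ1
  have hQ0 : Q ≠ 0 := by rintro rfl; simp at hQ1
  have hw := (hQ.memSigma hδ0 hδ1).weightNorm_pos hn hQ0
  have hd := (hQ.memSigma hδ0 hδ1).fracDerivNorm_pos hn hQ0
  have h1 := hQ.mul_eq_sharpConst_sq hn hδ0 hδ1 hQ1
  have h2 : 0 < sharpConst n δ ^ 2 := by rw [← h1]; positivity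
  exact lt_of_le_of_ne (Real.sqrt_nonneg _) fun h => by rw [← h] at h2; simp at h2

theorem two_mul_sharpConst_sq (hn : 0 < n) (hδ0 : 0 < δ) (hδ1 : δ < 1) :
    ENNReal.ofReal (2 * sharpConst n δ ^ 2) = groundEnergy n δ := by
  rw [sharpConst_sq hn hδ0 hδ1, mul_div_cancel₀ _ (two_ne_zero),
    ENNReal.ofReal_toReal (groundEnergy_lt_top n hδ0.le hδ1.le).ne]

theorem IsPositiveMinimizer.isGround (hn : 0 < n) (hδ0 : 0 < δ) (hδ1 : δ < 1) {Q : L2 n}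
    (hQ : IsPositiveMinimizer δ Q) : IsGround δ Q := by
  rw [isGround_iff hQ.norm_eq_one, hQ.memSigma.energy_eq, ← two_mul_sharpConst_sq hn hδ0 hδ1,
    ← hQ.minimizes, hQ.balanced]
  congr 1; ring

theorem IsPositiveMinimizer.eq_norm {Q : L2 n} (hQ : IsPositiveMinimizer δ Q) :
    ∀ᵐ x, Q x = ((‖Q x‖ : ℝ) : ℂ) := by
  filter_upwards [hQ.pos] with x hx
  have h1 : Q x = (((Q x).re : ℝ) : ℂ) := Complex.ext (by simp) (by simp [hx.2])
  rw [h1, Complex.norm_real, Real.norm_of_nonneg hx.1.le]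

theorem IsGround.isPositiveMinimizer (hn : 0 < n) (hδ0 : 0 < δ) (hδ1 : δ < 1) {Q : L2 n}
    (hQ : IsGround δ Q) (hQ1 : ‖Q‖ = 1) (hnn : ∀ᵐ x, Q x = ((‖Q x‖ : ℝ) : ℂ))
    (hpos : ∀ᵐ x, 0 < ‖Q x‖) : IsPositiveMinimizer δ Q where
  memSigma := hQ.memSigma hδ0 hδ1
  norm_eq_one := hQ1
  pos := by
    filter_upwards [hnn, hpos] with x h1 h2
    rw [h1]
    exact ⟨by simpa using h2, by simp⟩
  balanced := hQ.balanced hn hδ0 hδ1 hQ1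
  minimizes := hQ.mul_eq_sharpConst_sq hn hδ0 hδ1 hQ1

/-- The static uncertainty principle. -/
theorem sharpConst_pow_le_moment_mul (hn : 0 < n) (hδ0 : 0 < δ) (hδ1 : δ < 1) (f : L2 n)
    (hf1 : ‖f‖ = 1) :
    ENNReal.ofReal (sharpConst n δ ^ 4) ≤ moment δ f * moment δ (𝓕 f : L2 n) := by
  have hf0 : f ≠ 0 := by rintro rfl; simp at hf1
  by_cases hf : MemSigma δ f
  · rw [hf.moment_eq, hf.moment_fourier_eq, ← ENNReal.ofReal_mul (by positivity)]
    refine ENNReal.ofReal_le_ofReal ?_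
    have h1 := hf.groundEnergy_le_two_mul hn hδ0 hf1
    have h2 := sharpConst_sq hn hδ0 hδ1
    have h3 : sharpConst n δ ^ 2 ≤ weightNorm δ f * fracDerivNorm δ f := by linarith
    calc sharpConst n δ ^ 4 = (sharpConst n δ ^ 2) ^ 2 := by ring
      _ ≤ (weightNorm δ f * fracDerivNorm δ f) ^ 2 := by gcongr
      _ = _ := by ring
  -- Outside Σ_δ one moment is infinite and the other nonzero, so the product is infinite rather
  -- than 0 · ∞ = 0.
  · rw [memSigma_iff, not_and_or, not_lt_top_iff, not_lt_top_iff] at hf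
    have h1 : moment δ f ≠ 0 := fun h => hf0 ((moment_eq_zero_iff hn f).mp h)
    have h2 : moment δ (𝓕 f : L2 n) ≠ 0 := fun h =>
      fourier_ne_zero hf0 ((moment_eq_zero_iff hn _).mp h)
    rcases hf with h | h
    · rw [h, ENNReal.top_mul h2]; exact le_top
    · rw [h, ENNReal.mul_top h1]; exact le_top

/-- Equality in the static uncertainty principle. -/
theorem moment_mul_eq_iff (hn : 0 < n) (hδ0 : 0 < δ) (hδ1 : δ < 1) {Q : L2 n}
    (hQ : IsPositiveMinimizer δ Q) (f : L2 n) (hf1 : ‖f‖ = 1) :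
    moment δ f * moment δ (𝓕 f : L2 n) = ENNReal.ofReal (sharpConst n δ ^ 4) ↔
      ∃ lam : ℝ, 0 < lam ∧ ∃ c : ℂ, ‖c‖ = 1 ∧
        ∀ᵐ x, f x = c * (((lam ^ ((n : ℝ) / 2) : ℝ) : ℂ) * Q (lam • x)) := by
  have hf0 : f ≠ 0 := by rintro rfl; simp at hf1
  have hQg := hQ.isGround hn hδ0 hδ1
  constructor
  · intro h
    have h1 : moment δ f ≠ 0 := fun h => hf0 ((moment_eq_zero_iff hn f).mp h)
    have h2 : moment δ (𝓕 f : L2 n) ≠ 0 := fun h =>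
      fourier_ne_zero hf0 ((moment_eq_zero_iff hn _).mp h)
    have hf : MemSigma δ f := by
      rw [memSigma_iff]
      constructor
      · rw [lt_top_iff_ne_top]
        intro h'
        rw [h', ENNReal.top_mul h2] at h
        exact ENNReal.ofReal_ne_top h.symm
      · rw [lt_top_iff_ne_top]
        intro h'
        rw [h', ENNReal.mul_top h1] at h
        exact ENNReal.ofReal_ne_top h.symm
    have hw := weightNorm_nonneg (δ := δ) f
    have hd := fracDerivNorm_nonneg (δ := δ) f
    rw [hf.moment_eq, hf.moment_fourier_eq, ← ENNReal.ofReal_mul (by positivity),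
      ENNReal.ofReal_eq_ofReal_iff (by positivity) (by positivity)] at h
    have h3 : weightNorm δ f * fracDerivNorm δ f = sharpConst n δ ^ 2 := by
      refine (pow_left_inj₀ (by positivity) (by positivity) two_ne_zero).mp ?_
      rw [mul_pow, h]; ring
    -- Equality makes the balanced dilate g a ground state. Its modulus is Q by uniqueness and its
    -- phase is constant; undoing the dilation gives the form of f.
    obtain ⟨s, hs, h4⟩ := hf.exists_dilate_energy_eq hn hδ0 hf0
    set g := dilateL2 s hs.ne' f with hg
    have hg1 : ‖g‖ = 1 := by rw [hg, LinearIsometry.norm_map, hf1]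
    rw [h3, two_mul_sharpConst_sq hn hδ0 hδ1] at h4
    have hgg : IsGround δ g := (isGround_iff hg1).mpr h4
    obtain ⟨c, hc1, hc⟩ := hgg.exists_phase hn hδ0 hδ1
    have h5 : absL2 g = Q := by
      refine (hgg.modulus hn hδ0 hδ1).eq_of_nonneg hn hδ0 hδ1 hQg ?_ hQ.eq_norm
        (by rw [norm_absL2, hg1, hQ.norm_eq_one])
      filter_upwards [absL2_ae g] with x hx
      rw [hx]; simp
    have h6 : ∀ᵐ x, g x = c * Q x := by
      filter_upwards [hc, absL2_ae g] with x h7 h8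
      rw [← h5, h8, ← h7]
    have h7 : f = dilateL2 s⁻¹ (inv_ne_zero hs.ne') g := by
      have := dilateL2_dilateL2_inv s⁻¹ (inv_ne_zero hs.ne') f
      simp only [inv_inv] at this
      exact this.symm
    refine ⟨s⁻¹, inv_pos.mpr hs, c, hc1, ?_⟩
    filter_upwards [dilateL2_ae s⁻¹ (inv_ne_zero hs.ne') g,
      (quasiMeasurePreserving_smul_volume (inv_ne_zero hs.ne')).ae h6] with x h8 h9
    rw [h7, h8, h9, abs_of_pos (inv_pos.mpr hs)]
    ring
  · rintro ⟨lam, hlam, c, hc, h⟩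
    have h1 : f = c • dilateL2 lam hlam.ne' Q := by
      apply Lp.ext
      filter_upwards [h, dilateL2_ae lam hlam.ne' Q,
        Lp.coeFn_smul c (dilateL2 lam hlam.ne' Q)] with x h2 h3 h4
      rw [h2, h4, Pi.smul_apply, h3, smul_eq_mul, abs_of_pos hlam]
    have hw := weightNorm_nonneg (δ := δ) Q
    have hd := fracDerivNorm_nonneg (δ := δ) Q
    rw [h1, FourierTransform.fourier_smul, moment_smul, moment_smul, hc, moment_dilateL2,
      moment_fourier_dilateL2, hQ.memSigma.moment_eq, hQ.memSigma.moment_fourier_eq,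
      ← ENNReal.ofReal_mul (by positivity), ← ENNReal.ofReal_mul (by positivity),
      ← ENNReal.ofReal_mul (by positivity), ← ENNReal.ofReal_mul (by positivity),
      ← ENNReal.ofReal_mul (by positivity), Real.rpow_neg (abs_nonneg _), abs_of_pos hlam]
    congr 1
    have h2 : lam ^ (2 * δ) ≠ 0 := (Real.rpow_pos_of_pos hlam _).ne'
    have h3 : sharpConst n δ ^ 4 = (weightNorm δ Q * fracDerivNorm δ Q) ^ 2 := by
      rw [hQ.minimizes]; ring
    rw [h3]
    field_simp

/-! ### The evolution -/

theorem norm_schrodinger (f : L2 n) (t : ℝ) : ‖schrodinger f t‖ = ‖f‖ := by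
  rw [schrodinger_eq_fourierInv_mulUnit, ← Lp.norm_fourier_eq,
    FourierTransform.fourier_fourierInv_eq, LinearIsometry.norm_map, Lp.norm_fourier_eq]

theorem moment_fourier_schrodinger (f : L2 n) (t : ℝ) :
    moment δ (𝓕 (schrodinger f t) : L2 n) = moment δ (𝓕 f : L2 n) := by
  rw [schrodinger_eq_fourierInv_mulUnit, FourierTransform.fourier_fourierInv_eq]
  refine moment_congr_norm_ae ?_
  filter_upwards [mulUnit_ae (fun ξ : Rn n =>
      Complex.exp (((-Real.pi * t * ‖ξ‖ ^ 2 : ℝ) : ℂ) * Complex.I)) (by fun_prop)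
      (fun _ => Complex.norm_exp_ofReal_mul_I _) (𝓕 f)] with ξ hξ
  rw [hξ, norm_mul, Complex.norm_exp_ofReal_mul_I, one_mul]

theorem moment_chirpL2 (T : ℝ) (f : L2 n) : moment δ (chirpL2 T f) = moment δ f :=
  moment_congr_norm_ae ((chirpL2_ae T f).mono fun x hx => by rw [hx, norm_mul, norm_chirp, one_mul])

theorem hDelta_zero (f : L2 n) : hDelta δ f 0 = moment δ f := by
  rw [hDelta_eq_moment, schrodinger_zero]

theorem hDelta_eq {T : ℝ} (hT : T ≠ 0) (f : L2 n) :
    hDelta δ f T = ENNReal.ofReal (|T| ^ (2 * δ)) * moment δ (𝓕 (chirpL2 T f) : L2 n) := by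
  rw [hDelta_eq_moment, schrodinger_eq_fresnel f hT, moment_smul, norm_fresnelConst hT,
    moment_chirpL2, moment_dilateL2, abs_inv, Real.inv_rpow (abs_nonneg _),
    Real.rpow_neg (abs_nonneg _), inv_inv]
  simp

/-- The chirp is invisible to the moment at time 0, so both factors become moments of the same
function `chirpL2 T f`. -/
theorem hDelta_mul_eq {T : ℝ} (hT : T ≠ 0) (f : L2 n) :
    hDelta δ f 0 * hDelta δ f T = ENNReal.ofReal (|T| ^ (2 * δ)) *
      (moment δ (chirpL2 T f) * moment δ (𝓕 (chirpL2 T f) : L2 n)) := by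
  rw [hDelta_zero, hDelta_eq hT, moment_chirpL2]
  ring

theorem sharpConst_le_hDelta_mul (hn : 0 < n) (hδ0 : 0 < δ) (hδ1 : δ < 1) (f : L2 n)
    (hf1 : ‖f‖ = 1) {T : ℝ} (hT : T ≠ 0) :
    ENNReal.ofReal (sharpConst n δ ^ 4 * |T| ^ (2 * δ)) ≤ hDelta δ f 0 * hDelta δ f T := by
  rw [hDelta_mul_eq hT, mul_comm, ENNReal.ofReal_mul (by positivity)]
  refine mul_le_mul_right ?_ _
  exact sharpConst_pow_le_moment_mul hn hδ0 hδ1 _ (by rw [LinearIsometry.norm_map, hf1])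

theorem hDelta_lower_bound (hn : 0 < n) (hδ0 : 0 < δ) (hδ1 : δ < 1) {f : L2 n}
    (hf : MemSigma δ f) (hf1 : ‖f‖ = 1) (t : ℝ) :
    ENNReal.ofReal ((sharpConst n δ ^ 2 / (weightNorm δ f * fracDerivNorm δ f)) ^ 2 *
      max (weightNorm δ f ^ 2) (fracDerivNorm δ f ^ 2 * |t| ^ (2 * δ))) ≤ hDelta δ f t := by
  have hf0 : f ≠ 0 := by rintro rfl; simp at hf1
  have hw := hf.weightNorm_pos hn hf0
  have hd := hf.fracDerivNorm_pos hn hf0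
  rcases max_choice (weightNorm δ f ^ 2) (fracDerivNorm δ f ^ 2 * |t| ^ (2 * δ)) with h | h
  -- The first term is the static principle for u(·,t), whose frequency moment is conserved.
  · have h1 : (sharpConst n δ ^ 2 / (weightNorm δ f * fracDerivNorm δ f)) ^ 2 *
        weightNorm δ f ^ 2 = sharpConst n δ ^ 4 / fracDerivNorm δ f ^ 2 := by field_simp
    rw [h, h1, ENNReal.ofReal_div_of_pos (by positivity)]
    refine ENNReal.div_le_of_le_mul ?_
    rw [← hf.moment_fourier_eq, ← moment_fourier_schrodinger f t, hDelta_eq_moment]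
    exact sharpConst_pow_le_moment_mul hn hδ0 hδ1 _ (by rw [norm_schrodinger, hf1])
  -- The second term is the two-time product bound divided by h(0) = w². At t = 0 it vanishes
  -- because 2δ ≠ 0.
  · by_cases ht : t = 0
    · have : 2 * δ ≠ 0 := by positivity
      rw [h, ht, abs_zero, Real.zero_rpow this]
      simp
    · have h1 : (sharpConst n δ ^ 2 / (weightNorm δ f * fracDerivNorm δ f)) ^ 2 *
          (fracDerivNorm δ f ^ 2 * |t| ^ (2 * δ)) =
            sharpConst n δ ^ 4 * |t| ^ (2 * δ) / weightNorm δ f ^ 2 := by field_simp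
      rw [h, h1, ENNReal.ofReal_div_of_pos (by positivity)]
      refine ENNReal.div_le_of_le_mul ?_
      rw [← hf.moment_eq, mul_comm (hDelta δ f t), ← hDelta_zero]
      exact sharpConst_le_hDelta_mul hn hδ0 hδ1 f hf1 ht

/-- Static equality for `chirpL2 T f`; the factor e^{-πi|x|²/T} is the inverse of the chirp. -/
theorem hDelta_mul_eq_iff (hn : 0 < n) (hδ0 : 0 < δ) (hδ1 : δ < 1) {Q : L2 n}
    (hQ : IsPositiveMinimizer δ Q) (f : L2 n) (hf1 : ‖f‖ = 1) {T : ℝ} (hT : T ≠ 0) :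
    hDelta δ f 0 * hDelta δ f T = ENNReal.ofReal (sharpConst n δ ^ 4 * |T| ^ (2 * δ)) ↔
      ∃ lam : ℝ, 0 < lam ∧ ∃ c : ℂ, ‖c‖ = 1 ∧ ∀ᵐ x : EuclideanSpace ℝ (Fin n),
        f x = c * Complex.exp (-(Real.pi : ℂ) * Complex.I * ((‖x‖ ^ 2 : ℝ) : ℂ) / (T : ℂ)) *
          ((lam ^ ((n : ℝ) / 2) : ℝ) : ℂ) * Q (lam • x) := by
  have hT' : 0 < |T| ^ (2 * δ) := Real.rpow_pos_of_pos (abs_pos.mpr hT) _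
  rw [hDelta_mul_eq hT, mul_comm (sharpConst n δ ^ 4), ENNReal.ofReal_mul hT'.le,
    ENNReal.mul_right_inj (by simpa using hT') ENNReal.ofReal_ne_top,
    moment_mul_eq_iff hn hδ0 hδ1 hQ _ (by rw [LinearIsometry.norm_map, hf1])]
  refine exists_congr fun lam => and_congr_right fun _ => exists_congr fun c =>
    and_congr_right fun _ => eventually_congr ?_
  filter_upwards [chirpL2_ae T f] with x hx
  have h1 : Complex.exp (-(Real.pi : ℂ) * Complex.I * ((‖x‖ ^ 2 : ℝ) : ℂ) / (T : ℂ)) *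
      chirp T x = 1 := by
    rw [chirp, ← Complex.exp_add, Complex.exp_eq_one_iff]
    refine ⟨0, ?_⟩
    push_cast
    ring
  rw [hx]
  constructor
  · intro h
    linear_combination
      (Complex.exp (-(Real.pi : ℂ) * Complex.I * ((‖x‖ ^ 2 : ℝ) : ℂ) / (T : ℂ))) * h - f x * h1
  · intro h
    rw [h]
    linear_combination (c * ((lam ^ ((n : ℝ) / 2) : ℝ) : ℂ) * Q (lam • x)) * h1

end

/-! ### The main theorem. -/

theorem theorem2 (n : ℕ) (hn : 0 < n) (δ : ℝ) (hδ0 : 0 < δ) (hδ1 : δ < 1) :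
    0 < sharpConst n δ ∧
    ∃ Q : L2 n, IsPositiveMinimizer δ Q ∧ (∀ Q' : L2 n, IsPositiveMinimizer δ Q' → Q' = Q) ∧
      ∀ f : L2 n, MemSigma δ f → ‖f‖ = 1 →
        (∀ t : ℝ,
          ENNReal.ofReal
            ((sharpConst n δ ^ 2 / (weightNorm δ f * fracDerivNorm δ f)) ^ 2 *
              max (weightNorm δ f ^ 2) (fracDerivNorm δ f ^ 2 * |t| ^ (2 * δ)))
            ≤ hDelta δ f t) ∧
        (∀ T : ℝ, T ≠ 0 →
          ENNReal.ofReal (sharpConst n δ ^ 4 * |T| ^ (2 * δ)) ≤ hDelta δ f 0 * hDelta δ f T ∧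
          (hDelta δ f 0 * hDelta δ f T = ENNReal.ofReal (sharpConst n δ ^ 4 * |T| ^ (2 * δ)) ↔
            ∃ lam : ℝ, 0 < lam ∧ ∃ c : ℂ, ‖c‖ = 1 ∧
              ∀ᵐ x : EuclideanSpace ℝ (Fin n),
                f x = c * Complex.exp (-(Real.pi : ℂ) * Complex.I * ((‖x‖ ^ 2 : ℝ) : ℂ) / (T : ℂ)) *
                  ((lam ^ ((n : ℝ) / 2) : ℝ) : ℂ) * Q (lam • x))) := by
  obtain ⟨Q, hQ1, hQg, hnn, hpos⟩ := exists_pos_ground (n := n) hn hδ0 hδ1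
  have hQ := hQg.isPositiveMinimizer hn hδ0 hδ1 hQ1 hnn hpos
  refine ⟨sharpConst_pos hn hδ0 hδ1, Q, hQ, fun Q' hQ' => ?_, fun f hf hf1 =>
    ⟨hDelta_lower_bound hn hδ0 hδ1 hf hf1, fun T hT =>
      ⟨sharpConst_le_hDelta_mul hn hδ0 hδ1 f hf1 hT, hDelta_mul_eq_iff hn hδ0 hδ1 hQ f hf1 hT⟩⟩⟩
  exact (hQ'.isGround hn hδ0 hδ1).eq_of_nonneg hn hδ0 hδ1 hQg hQ'.eq_norm hnn
    (by rw [hQ'.norm_eq_one, hQ1])
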